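/- Let $K$ be an algebraically closed field of characteristic $0$, let $u,v\in K[x,y,z]$ and $h\in K[x,y]$, and consider the polynomial map $$H=\bigl(u(x,y,v(x,y,z)),\ v(x,y,z),\ h(x,y)\bigr):K^3\to K^3 .$$ Assume that $H(0)=0$, that the three components of $H$ are linearly independent over $K$, that the Jacobian matrix $JH$ is nilpotent, and that $\gcd(\deg u(x,y,0),\deg h(x,y))\le 3$, where $\deg$ is the total degree (with $\deg 0=0$ and $\gcd(0,n)=n$). Then there is $T\in\mathrm{GL}_3(K)$ such that $T^{-1}HT$ (the map $p\mapsto T^{-1}H(Tp)$) equals $$\bigl(u_1z-a^{-1}b'(y)\,g(ax+b(y))-u_1l_2y,\ \ g(ax+b(y)),\ \ c_0\,g(ax+b(y))^2+l_2\,g(ax+b(y))\bigr)$$ for some $u_1,c_0,a\in K\setminus\{0\}$, some $l_1,l_2,\tilde l_2\in K$, $b(y)=u_1c_0a\,y^2+l_1y+\tilde l_2$, and some $g\in K[t]$ with $g(0)=0$ and $\deg g\ge 1$. -/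

import Mathlib

namespace PolyMap

open MvPolynomial

/-- A polynomial map `K³ → K³`, given by its three components in `K[x, y, z]`;
the variables `x, y, z` are `X 0, X 1, X 2`. -/
abbrev PolyMap3 (K : Type*) [Field K] := Fin 3 → MvPolynomial (Fin 3) K

variable {K : Type*} [Field K]

/-- The Jacobian matrix `(∂Hᵢ/∂xⱼ)`, with entries in `K[x, y, z]`. -/
noncomputable def jacobian (H : PolyMap3 K) :
    Matrix (Fin 3) (Fin 3) (MvPolynomial (Fin 3) K) :=
  Matrix.of fun i j => pderiv j (H i)

/-- The linear conjugate `T⁻¹ H T`, i.e. the polynomial map `p ↦ T⁻¹ (H (T p))`. -/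
noncomputable def conj (T : GL (Fin 3) K) (H : PolyMap3 K) : PolyMap3 K := fun i =>
  ∑ j, C ((T⁻¹ : GL (Fin 3) K) i j) * bind₁ (fun k => ∑ l, C (T k l) * X l) (H j)

/-- For `u, v ∈ K[x, y, z]` and `h ∈ K[x, y]`, the map `(u(x, y, v), v(x, y, z), h(x, y))`. -/
noncomputable def composedMap (u v : MvPolynomial (Fin 3) K) (h : MvPolynomial (Fin 2) K) :
    PolyMap3 K :=
  ![bind₁ ![X 0, X 1, v] u, v, bind₁ ![X 0, X 1] h]

/-- The bivariate polynomial `u(x, y, 0)`. -/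
noncomputable def restrictZero (u : MvPolynomial (Fin 3) K) : MvPolynomial (Fin 2) K :=
  bind₁ ![X 0, X 1, 0] u

/-- The polynomial map with components
`u₁ z - a⁻¹ b'(y) g(a x + b(y)) - u₁ l₂ y`, `v = g(a x + b(y))`, `c₀ v² + l₂ v`. -/
noncomputable def normalMap (u₁ c₀ a l₂ : K) (b g : Polynomial K) : PolyMap3 K :=
  let v : MvPolynomial (Fin 3) K :=
    Polynomial.aeval (C a * X 0 + Polynomial.aeval (X 1) b) g
  ![C u₁ * X 2 - C a⁻¹ * Polynomial.aeval (X 1) (Polynomial.derivative b) * v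
      - C (u₁ * l₂) * X 1,
    v,
    C c₀ * v ^ 2 + C l₂ * v]

/-- `H` is one of the maps `normalMap u₁ c₀ a l₂ b g` with
`b(y) = u₁ c₀ a y² + l₁ y + l₃`, where `u₁, c₀, a` are nonzero, `g(0) = 0` and `deg g ≥ 1`. -/
def HasNormalForm (H : PolyMap3 K) : Prop :=
  ∃ (u₁ c₀ a l₁ l₂ l₃ : K) (g : Polynomial K),
    u₁ ≠ 0 ∧ c₀ ≠ 0 ∧ a ≠ 0 ∧ g.eval 0 = 0 ∧ 1 ≤ g.natDegree ∧
    H = normalMap u₁ c₀ a l₂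
      (Polynomial.C (u₁ * c₀ * a) * Polynomial.X ^ 2 + Polynomial.C l₁ * Polynomial.X
        + Polynomial.C l₃) g

end PolyMap

/-! Write D = ∂/∂x and E = ∂/∂y on R = K[x,y], and regard u, v as elements of R[z]. The Jacobian of
(u(x,y,v), v, h) being nilpotent means that its trace, the sum of its principal 2-minors and its
determinant vanish. If v were free of z, then u(x,y,v) and v would form a plane map with nilpotent
Jacobian, hence be linearly dependent modulo constants (`Plane.exists_linear_relation`). So v
depends on z, composition with v is injective, and the determinant equation becomes u_x h_y = u_y
h_x.

Comparing degrees and top coefficients in z gives h_x ≠ 0 (`NilpotentTriple.dx_ne_zero`), deg_z u ≤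
1 (`natDegree_le_one`) and u = wz + U(x,y) with w ∈ K (`coeff_one_eq_const`). The shear x ↦ x + wy,
together with subtracting w times the second component from the first, removes wz (`map_shear`).
Then v = V(x,y) + tz with t ∈ K nonzero (`exists_eq_add_C_mul_X`), and a plane system remains: U_x +
V_y = 0, U_x² + U_y V_x + t h_y = 0, U_x h_y = U_y h_x.

The core is to show U_x = c(x) U_y (`Plane.exists_dx_eq_mul_dy`). The leading coefficient of U in y
is constant. For a prime p dividing U_y the system gives p ∣ U_x, so U is constant on the curve p =
0. Writing U - k as a power of p times a cofactor compares the multiplicities of p in U_x and U_y,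
whence U_y ∣ U_x, and the quotient has degree 0 in y.

Integration then gives c' ∈ K, V = e(x) - cU with e' ∈ K, h quadratic in U, and U = r(y + b(x)) with
b' = c. Exchanging x and y yields the normal form, with a = 1. -/

open Polynomial

/-! ### Derivations acting on coefficients, and their chain rule. -/

/-- The derivation of `R[X]` applying `d` to every coefficient. -/
noncomputable def Derivation.coeffwise {K R : Type*} [Field K] [CommRing R] [Algebra K R]
    (d : Derivation K R R) : Derivation K R[X] R[X] :=
  (PolynomialModule.equivPolynomialSelf.toLinearMap).compDer d.mapCoeffs

section Coeffwise

variable {K R : Type*} [Field K] [CommRing R] [Algebra K R] (d : Derivation K R R)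

@[simp]
theorem Derivation.coeff_coeffwise (p : R[X]) (n : ℕ) :
    (d.coeffwise p).coeff n = d (p.coeff n) := by
  rfl

@[simp]
theorem Derivation.coeffwise_C (a : R) : d.coeffwise (C a) = C (d a) := by
  ext n
  simp only [Derivation.coeff_coeffwise, coeff_C]
  split_ifs <;> simp

@[simp]
theorem Derivation.coeffwise_X : d.coeffwise (X : R[X]) = 0 := by
  ext n
  simp only [Derivation.coeff_coeffwise, coeff_X, coeff_zero]
  split_ifs <;> simp

theorem Derivation.natDegree_coeffwise_le (p : R[X]) :
    (d.coeffwise p).natDegree ≤ p.natDegree := by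
  refine natDegree_le_iff_coeff_eq_zero.2 fun n hn => ?_
  simp [coeff_eq_zero_of_natDegree_lt hn]

theorem Derivation.coeffwise_comp (u v : R[X]) :
    d.coeffwise (u.comp v) =
      (d.coeffwise u).comp v + (derivative u).comp v * d.coeffwise v := by
  induction u using Polynomial.induction_on' with
  | add p q hp hq => simp [hp, hq]; ring
  | monomial n a =>
    have h1 : d.coeffwise (monomial n a) = monomial n (d a) := by
      ext m; simp only [Derivation.coeff_coeffwise, coeff_monomial]; split_ifs <;> simp
    rw [h1, monomial_comp, monomial_comp, derivative_monomial, monomial_comp, Derivation.leibniz,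
      Derivation.leibniz_pow, Derivation.coeffwise_C]
    simp
    ring

end Coeffwise

/-! ### The partial derivatives of K[x][y]: `C X` is x and the outer `X` is y. -/

namespace Plane

section

variable (K : Type*) [Field K]

/-- The derivation `∂/∂x` of `K[x][y]`. -/
noncomputable def dx : Derivation K K[X][X] K[X][X] :=
  (derivative' : Derivation K K[X] K[X]).coeffwise

/-- The derivation `∂/∂y` of `K[x][y]`. -/
noncomputable def dy : Derivation K K[X][X] K[X][X] :=
  (derivative' : Derivation K[X] K[X][X] K[X][X]).restrictScalars K

end

variable {K : Type*} [Field K]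

@[simp]
theorem coeff_dx (p : K[X][X]) (n : ℕ) : (dx K p).coeff n = derivative (p.coeff n) := rfl

theorem dy_apply (p : K[X][X]) : dy K p = derivative p := rfl

theorem coeff_dy (p : K[X][X]) (n : ℕ) :
    (dy K p).coeff n = p.coeff (n + 1) * ((n : K[X]) + 1) := by
  rw [dy_apply, coeff_derivative]

@[simp]
theorem dx_C (a : K[X]) : dx K (C a) = C (derivative a) := by
  simp [dx]

@[simp]
theorem dy_C (a : K[X]) : dy K (C a) = 0 := by
  simp [dy_apply]

@[simp]
theorem dx_X : dx K (X : K[X][X]) = 0 := by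
  simp [dx]

@[simp]
theorem dy_X : dy K (X : K[X][X]) = 1 := by
  simp [dy_apply]

theorem dx_dy_comm (p : K[X][X]) : dx K (dy K p) = dy K (dx K p) := by
  ext1 n
  simp only [coeff_dx, coeff_dy, derivative_mul, derivative_add, derivative_natCast,
    derivative_one]
  ring

theorem natDegree_dx_le (p : K[X][X]) : (dx K p).natDegree ≤ p.natDegree :=
  Derivation.natDegree_coeffwise_le _ p

theorem dx_comp (p q : K[X][X]) :
    dx K (p.comp q) = (dx K p).comp q + (derivative p).comp q * dx K q :=
  Derivation.coeffwise_comp _ p q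

theorem dy_comp (p q : K[X][X]) :
    dy K (p.comp q) = (derivative p).comp q * dy K q := by
  rw [dy_apply, dy_apply, derivative_comp, mul_comm]

variable [CharZero K]

theorem natDegree_le_of_natDegree_dy_le {p : K[X][X]} {n : ℕ} (hp : (dy K p).natDegree ≤ n) :
    p.natDegree ≤ n + 1 := by
  refine natDegree_le_iff_coeff_eq_zero.2 fun k hk => ?_
  obtain ⟨j, rfl⟩ : ∃ j, k = j + 1 := ⟨k - 1, by omega⟩
  have h1 := coeff_dy p j
  rw [coeff_eq_zero_of_natDegree_lt (by omega)] at h1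
  have h2 : ((j : K[X]) + 1) ≠ 0 := by exact_mod_cast Nat.succ_ne_zero j
  simpa [h2] using h1.symm

theorem dy_eq_zero_iff {p : K[X][X]} : dy K p = 0 ↔ p = C (p.coeff 0) := by
  constructor
  · intro h
    exact eq_C_of_derivative_eq_zero h
  · intro h
    rw [h, dy_C]

theorem exists_const {p : K[X][X]} (hx : dx K p = 0) (hy : dy K p = 0) :
    ∃ k : K, p = algebraMap K K[X][X] k := by
  rw [dy_eq_zero_iff] at hy
  rw [hy, dx_C, C_eq_zero] at hx
  rw [hy, eq_C_of_derivative_eq_zero hx]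
  exact ⟨_, rfl⟩

theorem natDegree_dy {p : K[X][X]} : (dy K p).natDegree = p.natDegree - 1 :=
  natDegree_derivative p

/-- A nonzero ∂a/∂y has smaller degree in y than a. Squares are needed because one minor equation
controls only the square of a derivative. -/
theorem dy_eq_zero_of_sq_dvd {a : K[X][X]} (h : a ^ 2 ∣ dy K a ^ 2) : dy K a = 0 := by
  by_contra h0
  have h1 := natDegree_le_of_dvd h (pow_ne_zero 2 h0)
  rw [natDegree_pow, natDegree_pow, natDegree_dy] at h1
  have : a.natDegree ≠ 0 := fun h2 => h0 (by
    rw [eq_C_of_natDegree_eq_zero h2, dy_C])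
  omega

theorem swap_dx (p : K[X][X]) : Bivariate.swap (dx K p) = dy K (Bivariate.swap p) := by
  induction p using Polynomial.induction_on' with
  | add p q hp hq => simp [hp, hq]
  | monomial n a =>
    have h1 : dx K (monomial n a) = monomial n (derivative a) := by
      ext1 m; simp only [coeff_dx, coeff_monomial]; split_ifs <;> simp
    rw [h1, Bivariate.swap_monomial, Bivariate.swap_monomial, dy_apply, derivative_mul]
    simp [derivative_map]

/-- The degree in x is additive on products, so a nonzero product free of x has factors free of x.
The swap of the variables turns this into a statement about `natDegree`. -/
theorem dx_eq_zero_of_mul {a b : K[X][X]} (h : dx K (a * b) = 0) (hab : a * b ≠ 0) :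
    dx K a = 0 := by
  have h1 := congrArg Bivariate.swap h
  rw [swap_dx, map_mul, map_zero, dy_apply] at h1
  have h2 := derivative_eq_zero.1 h1
  have h3 : Bivariate.swap a * Bivariate.swap b ≠ 0 := by
    rw [← map_mul]; simpa using hab
  rw [natDegree_mul (left_ne_zero_of_mul h3) (right_ne_zero_of_mul h3)] at h2
  have h4 : dy K (Bivariate.swap a) = 0 := by
    rw [dy_apply, eq_C_of_natDegree_eq_zero (p := Bivariate.swap a) (by omega), derivative_C]
  rw [← swap_dx] at h4
  simpa using h4

end Plane

/-! ### The leading coefficient of U in y is constant. -/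

/-- The comparison of leading coefficients for the operator `X * d/dX`. -/
theorem Polynomial.natDegree_eq_zero_of_hessian {K : Type*} [Field K] [CharZero K] {A B : K[X]}
    (hA : A ≠ 0) {M : ℕ}
    (h1 : ((M : K[X]) + 1) * derivative A ^ 2 - (M : K[X]) * A * derivative (derivative A)
      + ((M : K[X]) + 1) * (2 * (M : K[X]) + 1) * B = 0)
    (h2 : derivative A * B * (2 * (M : K[X]) + 1) = (M : K[X]) * A * derivative B) :
    A.natDegree = 0 := by
  have hco : ∀ (p : K[X]) (n : ℕ), (X * derivative p).coeff n = n * p.coeff n := by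
    intro p n
    cases n with
    | zero => simp
    | succ n => rw [coeff_X_mul, coeff_derivative]; push_cast; ring
  have hdeg : ∀ p : K[X], (X * derivative p).natDegree ≤ p.natDegree := fun p =>
    natDegree_le_iff_coeff_eq_zero.2 fun n hn => by
      rw [hco, coeff_eq_zero_of_natDegree_lt hn, mul_zero]
  set e := A.natDegree with he
  set T : K[X] := X * derivative A with hT
  -- The operator X·d/dX multiplies the coefficient of Xⁿ by n, so multiplying the first equation by
  -- X² and the second by X makes top coefficients directly comparable.
  have hTT : X * derivative T = T + X ^ 2 * derivative (derivative A) := by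
    rw [hT, derivative_mul, derivative_X]; ring
  have hTe : T.natDegree ≤ e := hdeg A
  have hTTe : (X * derivative T).natDegree ≤ e := (hdeg T).trans hTe
  have hTTT : (X * derivative T - T).natDegree ≤ e := (natDegree_sub_le_of_le hTTe hTe).trans (max_self e).le
  have hcT : T.coeff e = e * A.leadingCoeff := hco A e
  have hcTT : (X * derivative T - T).coeff e = (e * e - e) * A.leadingCoeff := by
    rw [coeff_sub, hco, hcT]; ring
  have h1' : ((M : K[X]) + 1) * (T * T) - (M : K[X]) * (A * (X * derivative T - T))
      = - (((M : K[X]) + 1) * (2 * (M : K[X]) + 1) * (X ^ 2 * B)) := by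
    rw [hTT, hT]; linear_combination X ^ 2 * h1
  have hMC : ((M : K[X]) + 1) = C ((M : K) + 1) := by simp
  have hMC' : (M : K[X]) = C (M : K) := by simp
  have hMC2 : (2 * (M : K[X]) + 1) = C (2 * (M : K) + 1) := by
    simp only [map_add, map_mul, map_natCast, map_ofNat, map_one]
  have hA0 : A.leadingCoeff ≠ 0 := leadingCoeff_ne_zero.2 hA
  have hM1 : (M : K) + 1 ≠ 0 := by exact_mod_cast Nat.succ_ne_zero M
  have hM2 : 2 * (M : K) + 1 ≠ 0 := by exact_mod_cast Nat.succ_ne_zero (2 * M)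
  by_cases hB : B = 0
  · rw [hB, mul_zero, mul_zero, neg_zero, hMC, hMC'] at h1'
    have h3 := congrArg (fun p => coeff p (e + e)) h1'
    simp only [coeff_sub, coeff_C_mul, coeff_zero] at h3
    rw [coeff_mul_add_eq_of_natDegree_le hTe hTe, coeff_mul_add_eq_of_natDegree_le he.ge hTTT, hcT, hcTT,
      he, coeff_natDegree, ← he] at h3
    -- The coefficient of degree 2e carries the factor (M+1)e² - M(e² - e) = e(e + M).
    have h4 : A.leadingCoeff ^ 2 * ((e : K) * (e + M)) = 0 := by linear_combination h3
    have h5 : (e : K) * (e + M) = 0 := by simpa [hA0] using h4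
    have h6 : e * (e + M) = 0 := by exact_mod_cast h5
    rcases mul_eq_zero.1 h6 with h | h <;> omega
  · set b := B.natDegree with hb
    have hB0 : B.leadingCoeff ≠ 0 := leadingCoeff_ne_zero.2 hB
    have h2' : C (2 * (M : K) + 1) * (T * B) = C (M : K) * (A * (X * derivative B)) := by
      rw [← hMC2, ← hMC', hT]; linear_combination X * h2
    have h3 := congrArg (fun p => coeff p (e + b)) h2'
    simp only [coeff_C_mul] at h3
    rw [coeff_mul_add_eq_of_natDegree_le hTe hb.ge, coeff_mul_add_eq_of_natDegree_le he.ge (hdeg B), hcT, hco,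
      he, hb, coeff_natDegree, coeff_natDegree, ← he, ← hb] at h3
    have h4 : (A.leadingCoeff * B.leadingCoeff) * ((2 * (M : K) + 1) * e - M * b) = 0 := by
      linear_combination h3
    have h5 : (2 * (M : K) + 1) * e - M * b = 0 := by simpa [hA0, hB0] using h4
    have h6 : (2 * M + 1) * e = M * b := by
      have := sub_eq_zero.1 h5
      exact_mod_cast this
    by_contra hne
    -- If e > 0, then (2M+1)e = Mb forces b > 2e, so X²B has larger degree than the other terms of
    -- the first equation and nothing can cancel its leading term.
    have h7 : 2 * e < b := by
      by_contra hlt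
      have : M * b ≤ M * (2 * e) := Nat.mul_le_mul_left M (by omega)
      have h8 : (2 * M + 1) * e = M * (2 * e) + e := by ring
      omega
    have h8 := congrArg (fun p => coeff p (b + 2)) h1'
    rw [hMC, hMC2, hMC'] at h8
    simp only [coeff_sub, coeff_neg, mul_assoc, coeff_C_mul] at h8
    rw [coeff_eq_zero_of_natDegree_lt (p := T * T)
        (lt_of_le_of_lt (natDegree_mul_le_of_le hTe hTe) (by omega)),
      coeff_eq_zero_of_natDegree_lt (p := A * _)
        (lt_of_le_of_lt (natDegree_mul_le_of_le he.ge hTTT) (by omega)),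
      add_comm b 2, add_comm 2 b, coeff_X_pow_mul, hb, coeff_natDegree] at h8
    simp [hM1, hM2, hB] at h8

namespace Plane

variable {K : Type*} [Field K] [CharZero K]

/-- With deg_y U = m+1, the equations bound deg_y V by m+2 and deg_y h by 2m+3. Their top
coefficients in y relate the leading coefficient A of U to the coefficient B of y^(2m+3) in h; the
coefficient of y^(m+2) in V is eliminated through the trace equation. -/
theorem derivative_leadingCoeff_eq_zero {U V h : K[X][X]} (hT : dx K U + dy K V = 0)
    (hN : dx K U ^ 2 + dy K U * dx K V + dy K h = 0) (hJ : dx K U * dy K h = dy K U * dx K h)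
    (hU : dy K U ≠ 0) : derivative U.leadingCoeff = 0 := by
  obtain ⟨m, hm⟩ : ∃ m, U.natDegree = m + 1 := by
    refine ⟨U.natDegree - 1, ?_⟩
    have : U.natDegree ≠ 0 := fun h2 => hU (by rw [eq_C_of_natDegree_eq_zero h2, dy_C])
    omega
  have hxU : (dx K U).natDegree ≤ m + 1 := hm ▸ natDegree_dx_le U
  have hyU : (dy K U).natDegree ≤ m := by rw [natDegree_dy, hm]; omega
  have hyV : dy K V = - dx K U := by linear_combination hT
  have hV : V.natDegree ≤ m + 2 :=
    natDegree_le_of_natDegree_dy_le (by rw [hyV, natDegree_neg]; exact hxU)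
  have hxV : (dx K V).natDegree ≤ m + 2 := (natDegree_dx_le V).trans hV
  have hyh' : dy K h = - (dx K U * dx K U + dy K U * dx K V) := by linear_combination hN
  have hyh : (dy K h).natDegree ≤ 2 * m + 2 := by
    rw [hyh', natDegree_neg]
    exact natDegree_add_le_of_degree_le
      ((natDegree_mul_le_of_le hxU hxU).trans (by omega))
      ((natDegree_mul_le_of_le hyU hxV).trans (by omega))
  have hh : h.natDegree ≤ 2 * m + 3 := natDegree_le_of_natDegree_dy_le hyh
  have hxh : (dx K h).natDegree ≤ 2 * m + 3 := (natDegree_dx_le h).trans hh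
  have hA : U.coeff (m + 1) = U.leadingCoeff := by rw [leadingCoeff, hm]
  set A := U.leadingCoeff with hAdef
  set B := h.coeff (2 * m + 3) with hB
  have hcV : V.coeff (m + 2) * ((m : K[X]) + 1 + 1) = - derivative A := by
    have := congrArg (fun p => coeff p (m + 1)) hyV
    simp only [coeff_dy, coeff_neg, coeff_dx, hA] at this
    exact_mod_cast this
  have hcV' : derivative (V.coeff (m + 2)) * ((m : K[X]) + 1 + 1) = - derivative (derivative A) := by
    have := congrArg derivative hcV
    simpa using this
  have e1 := congrArg (fun p => coeff p (m + (m + 2))) hN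
  simp only [sq, coeff_add, coeff_zero] at e1
  rw [coeff_mul_add_eq_of_natDegree_le hyU hxV, show m + (m + 2) = (m + 1) + (m + 1) by ring,
    coeff_mul_add_eq_of_natDegree_le hxU hxU, coeff_dy, coeff_dy, coeff_dx, coeff_dx, hA,
    show m + 1 + (m + 1) + 1 = 2 * m + 3 by ring, ← hB] at e1
  have e2 := congrArg (fun p => coeff p ((m + 1) + (2 * m + 2))) hJ
  rw [coeff_mul_add_eq_of_natDegree_le hxU hyh, show m + 1 + (2 * m + 2) = m + (2 * m + 3) by ring,
    coeff_mul_add_eq_of_natDegree_le hyU hxh, coeff_dx, coeff_dy, coeff_dx, coeff_dy, hA, ← hB] at e2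
  have h0 : A.natDegree = 0 := by
    have hA0 : A ≠ 0 := by
      rw [hAdef]
      refine leadingCoeff_ne_zero.2 fun h0 => hU (by rw [h0, map_zero])
    refine Polynomial.natDegree_eq_zero_of_hessian (B := B) hA0 (M := m + 1) ?_ ?_
    · push_cast at e1 ⊢
      linear_combination ((m : K[X]) + 1 + 1) * e1 - A * (m + 1) * hcV'
    · push_cast at e2 ⊢
      linear_combination e2
  rw [eq_C_of_natDegree_eq_zero h0, derivative_C]

end Plane

/-! ### Solving the plane system: U_y divides U_x. -/

namespace Plane

variable {K : Type*} [Field K]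

/-- This makes the descent in `exists_const_of_prime_dvd` terminate. -/
theorem iterate_dx_eq_zero (p : K[X][X]) : ∃ n, (dx K)^[n] p = 0 := by
  refine ⟨p.support.sup (fun i => (p.coeff i).natDegree) + 1, ?_⟩
  have hco : ∀ (n : ℕ) (q : K[X][X]) (i : ℕ),
      ((dx K)^[n] q).coeff i = derivative^[n] (q.coeff i) := by
    intro n
    induction n with
    | zero => intro q i; rfl
    | succ n ih => intro q i; rw [Function.iterate_succ_apply, ih]; rfl
  ext1 i
  rw [hco, coeff_zero]
  by_cases hi : i ∈ p.support
  · exact iterate_derivative_eq_zero (Nat.lt_succ_of_le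
      (Finset.le_sup (f := fun i => (p.coeff i).natDegree) hi))
  · rw [notMem_support_iff.1 hi, iterate_derivative_zero]

/-- A polynomial is integral over `K[x]` modulo a polynomial which is monic in `y` up to a unit. -/
theorem exists_monic_dvd_comp {p : K[X][X]} (hp : IsUnit p.leadingCoeff) (U : K[X][X]) :
    ∃ R : K[X][X], R.Monic ∧ p ∣ R.comp U := by
  obtain ⟨c, hc⟩ := hp
  have hm : (C (↑c⁻¹ : K[X]) * p).Monic := by
    have : (↑c⁻¹ : K[X]) * p.leadingCoeff = 1 := by rw [← hc, Units.inv_mul]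
    exact monic_C_mul_of_mul_leadingCoeff_eq_one this
  have := hm.finite_quotient
  obtain ⟨R, hR, hR0⟩ := IsIntegral.of_finite K[X]
    (Ideal.Quotient.mk (Ideal.span {C (↑c⁻¹ : K[X]) * p}) U)
  refine ⟨R, hR, ?_⟩
  have h1 : Ideal.Quotient.mk (Ideal.span {C (↑c⁻¹ : K[X]) * p}) (R.comp U) = 0 := by
    rw [← hR0, comp, hom_eval₂]
    rfl
  rw [Ideal.Quotient.eq_zero_iff_mem, Ideal.mem_span_singleton] at h1
  exact (Dvd.intro_left _ rfl).trans h1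

variable [CharZero K]

theorem not_dvd_dy {p : K[X][X]} (hp : Prime p) (hlc : IsUnit p.leadingCoeff) : ¬ p ∣ dy K p := by
  intro h
  have h0 : p.natDegree ≠ 0 := fun h0 => hp.not_isUnit (by
    rw [eq_C_of_natDegree_eq_zero h0]
    rw [leadingCoeff, h0] at hlc
    exact isUnit_C.2 hlc)
  by_cases hz : dy K p = 0
  · rw [dy_eq_zero_iff] at hz
    exact h0 (by rw [hz, natDegree_C])
  · have := natDegree_le_of_dvd h hz
    rw [natDegree_dy] at this
    omega

/-- A polynomial whose differential vanishes along an irreducible curve is constant on it. -/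
theorem exists_const_of_prime_dvd [IsAlgClosed K] {p U : K[X][X]} (hp : Prime p)
    (hlc : IsUnit p.leadingCoeff) (hx : p ∣ dx K U) (hy : p ∣ dy K U) :
    ∃ k : K, p ∣ U - algebraMap K K[X][X] k := by
  -- Relations R(x, U) ≡ 0 mod p are stable under ∂/∂x of the coefficients. Differentiating R(x, U)
  -- = pS in y gives p ∣ S·p_y, hence p ∣ S; differentiating in x then gives the claim.
  have hclosed : ∀ R : K[X][X], p ∣ R.comp U → p ∣ (dx K R).comp U := by
    rintro R ⟨S, hS⟩
    have h1 := dy_comp R U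
    rw [hS, Derivation.leibniz, smul_eq_mul, smul_eq_mul] at h1
    have h2 : p ∣ S * dy K p := by
      have : p ∣ (derivative R).comp U * dy K U - p * dy K S :=
        dvd_sub (hy.mul_left _) (dvd_mul_right _ _)
      rwa [← h1, add_sub_cancel_left] at this
    have h3 : p ∣ S := (hp.dvd_or_dvd h2).resolve_right (not_dvd_dy hp hlc)
    have h4 := dx_comp R U
    rw [hS, Derivation.leibniz, smul_eq_mul, smul_eq_mul] at h4
    have h5 : (dx K R).comp U = p * dx K S + S * dx K p - (derivative R).comp U * dx K U := by
      rw [h4]; ring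
    rw [h5]
    exact dvd_sub (dvd_add (dvd_mul_right _ _) (h3.mul_right _)) (hx.mul_left _)
  obtain ⟨R, hR, hRU⟩ := exists_monic_dvd_comp hlc U
  -- The last nonzero iterated derivative of R is a relation with coefficients in K. It splits into
  -- linear factors, and the prime p must divide some U - k.
  obtain ⟨S, hS0, hSU, hSx⟩ : ∃ S : K[X][X], S ≠ 0 ∧ p ∣ S.comp U ∧ dx K S = 0 := by
    obtain ⟨n, hn⟩ := iterate_dx_eq_zero R
    by_contra! hcon
    have key : ∀ n, (dx K)^[n] R ≠ 0 ∧ p ∣ ((dx K)^[n] R).comp U := by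
      intro n
      induction n with
      | zero => exact ⟨hR.ne_zero, hRU⟩
      | succ n ih =>
        rw [Function.iterate_succ_apply']
        exact ⟨hcon _ ih.1 ih.2, hclosed _ ih.2⟩
    exact (key n).1 hn
  have hSr : S = (S.map (evalRingHom 0)).map C := by
    ext1 i
    have h1 : derivative (S.coeff i) = 0 := by rw [← coeff_dx, hSx, coeff_zero]
    rw [coeff_map, coeff_map, eq_C_of_derivative_eq_zero h1]
    simp
  set r := S.map (evalRingHom (0 : K)) with hr
  have hr0 : r ≠ 0 := by
    intro h0
    rw [h0, Polynomial.map_zero] at hSr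
    exact hS0 hSr
  have hspl := (IsAlgClosed.splits r).eq_prod_roots
  rw [hSr, hspl, Polynomial.map_mul, mul_comp, map_C, C_comp, Polynomial.map_multiset_prod,
    multiset_prod_comp] at hSU
  rcases hp.dvd_or_dvd hSU with h1 | h1
  · exfalso
    refine hp.not_isUnit (isUnit_of_dvd_unit h1 (isUnit_C.2 (isUnit_C.2 ?_)))
    exact isUnit_iff_ne_zero.2 (leadingCoeff_ne_zero.2 hr0)
  · obtain ⟨q, hq, hpq⟩ := hp.exists_mem_multiset_dvd h1
    simp only [Multiset.map_map, Multiset.mem_map, Function.comp] at hq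
    obtain ⟨k, -, rfl⟩ := hq
    refine ⟨k, ?_⟩
    simpa using hpq

/-- With U - k = p^(j+1) g and p ∤ g, every derivative of U is divisible by p^j, while p^j is the
exact power in U_y because p ∤ p_y. -/
theorem pow_dvd_dx_of_pow_dvd_dy [IsAlgClosed K] {p U : K[X][X]} (hp : Prime p)
    (hlc : IsUnit p.leadingCoeff) (hU : dy K U ≠ 0) (hx : p ∣ dy K U → p ∣ dx K U) {n : ℕ}
    (hn : p ^ n ∣ dy K U) : p ^ n ∣ dx K U := by
  rcases Nat.eq_zero_or_pos n with rfl | hpos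
  · simp
  have hpy : p ∣ dy K U := (dvd_pow_self p hpos.ne').trans hn
  obtain ⟨k, hk⟩ := exists_const_of_prime_dvd hp hlc (hx hpy) hpy
  have hy' : dy K (U - algebraMap K K[X][X] k) = dy K U := by simp
  have hx' : dx K (U - algebraMap K K[X][X] k) = dx K U := by simp
  have hne : U - algebraMap K K[X][X] k ≠ 0 := by
    intro h0
    rw [h0, map_zero] at hy'
    exact hU hy'.symm
  obtain ⟨m, g, hg, hUg⟩ := WfDvdMonoid.max_power_factor hne hp.irreducible
  obtain ⟨j, rfl⟩ : ∃ j, m = j + 1 := by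
    refine ⟨m - 1, ?_⟩
    have : m ≠ 0 := by
      rintro rfl
      rw [pow_zero, one_mul] at hUg
      exact hg (hUg ▸ hk)
    omega
  have hD : ∀ D : Derivation K K[X][X] K[X][X], D (U - algebraMap K K[X][X] k) =
      p ^ j * (((j : K[X][X]) + 1) * D p * g + p * D g) := by
    intro D
    rw [hUg, Derivation.leibniz, Derivation.leibniz_pow]
    simp only [smul_eq_mul, nsmul_eq_mul, Nat.add_sub_cancel]
    push_cast
    ring
  rw [← hx', hD]
  rw [← hy', hD] at hn
  refine Dvd.dvd.mul_right (pow_dvd_pow p ?_) _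
  by_contra hlt
  have h1 : p ^ j * p ∣ p ^ j * (((j : K[X][X]) + 1) * dy K p * g + p * dy K g) :=
    (pow_succ p j ▸ pow_dvd_pow p (by omega : j + 1 ≤ n)).trans hn
  have h2 := (mul_dvd_mul_iff_left (pow_ne_zero j hp.ne_zero)).1 h1
  have h3 : p ∣ ((j : K[X][X]) + 1) * dy K p * g := (dvd_add_left (dvd_mul_right p _)).1 h2
  rcases hp.dvd_or_dvd h3 with h4 | h4
  · rcases hp.dvd_or_dvd h4 with h5 | h5
    · refine hp.not_isUnit (isUnit_of_dvd_unit h5 ?_)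
      have : ((j : K[X][X]) + 1) = C (C ((j : K) + 1)) := by simp
      rw [this]
      exact isUnit_C.2 (isUnit_C.2 (isUnit_iff_ne_zero.2 (by exact_mod_cast Nat.succ_ne_zero j)))
    · exact not_dvd_dy hp hlc h5
  · exact hg h4

/-- A function `U` with `U_x² + U_y V_x + h_y = 0`, `U_x + V_y = 0` and `J(U, h) = 0` is constant
along a vector field `∂/∂x - c(x) ∂/∂y`. -/
theorem exists_dx_eq_mul_dy [IsAlgClosed K] {U V h : K[X][X]} (hT : dx K U + dy K V = 0)
    (hN : dx K U ^ 2 + dy K U * dx K V + dy K h = 0) (hJ : dx K U * dy K h = dy K U * dx K h)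
    (hU : dy K U ≠ 0) : ∃ c : K[X], dx K U = C c * dy K U := by
  have hA := derivative_leadingCoeff_eq_zero hT hN hJ hU
  have hdeg : U.natDegree ≠ 0 := fun h2 => hU (by rw [eq_C_of_natDegree_eq_zero h2, dy_C])
  have hUlc : IsUnit U.leadingCoeff := by
    rw [eq_C_of_derivative_eq_zero hA]
    refine isUnit_C.2 (isUnit_iff_ne_zero.2 fun h0 => ?_)
    have h1 := eq_C_of_derivative_eq_zero hA
    rw [h0, C_0, leadingCoeff_eq_zero] at h1
    exact hU (by rw [h1, map_zero])
  have hyUlc : IsUnit (dy K U).leadingCoeff := by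
    rw [leadingCoeff, natDegree_dy, coeff_dy, Nat.sub_add_cancel (Nat.one_le_iff_ne_zero.2 hdeg)]
    refine hUlc.mul ?_
    have : ((U.natDegree - 1 : ℕ) : K[X]) + 1 = C (U.natDegree : K) := by
      rw [← Nat.cast_succ, Nat.succ_eq_add_one,
        Nat.sub_add_cancel (Nat.one_le_iff_ne_zero.2 hdeg), map_natCast]
    rw [this]
    exact isUnit_C.2 (isUnit_iff_ne_zero.2 (Nat.cast_ne_zero.2 hdeg))
  have hdvd : dy K U ∣ dx K U := by
    rw [UniqueFactorizationMonoid.dvd_iff_emultiplicity_le hU]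
    intro p hp
    refine emultiplicity_le_emultiplicity_iff.2 fun n hn => ?_
    by_cases hpy : p ∣ dy K U
    · have hplc : IsUnit p.leadingCoeff := by
        obtain ⟨q, hq⟩ := hpy
        rw [hq, leadingCoeff_mul] at hyUlc
        exact isUnit_of_mul_isUnit_left hyUlc
      refine pow_dvd_dx_of_pow_dvd_dy hp hplc hU (fun _ => ?_) hn
      -- From U_x h_y = U_y h_x, p divides U_x or h_y; in the second case U_x² = -U_y V_x - h_y is
      -- divisible by p.
      have key : p ∣ dy K h → p ∣ dx K U := fun hph => by
        have : dx K U ^ 2 = dy K U * (-dx K V) - dy K h := by linear_combination hN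
        refine hp.dvd_of_dvd_pow (n := 2) ?_
        rw [this]
        exact dvd_sub (hpy.mul_right _) hph
      exact (hp.dvd_or_dvd (hJ ▸ hpy.mul_right _ : p ∣ dx K U * dy K h)).elim id key
    · have : n = 0 := by
        by_contra hne
        exact hpy ((dvd_pow_self p hne).trans hn)
      simp [this]
  obtain ⟨q, hq⟩ := hdvd
  -- Constancy of the leading coefficient lowers the degree of U_x in y to that of U_y, so the
  -- quotient is free of y.
  have hxdeg : (dx K U).natDegree ≤ U.natDegree - 1 := by
    refine natDegree_le_iff_coeff_eq_zero.2 fun n hn => ?_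
    rw [coeff_dx]
    rcases (show n = U.natDegree ∨ U.natDegree < n by omega) with rfl | h1
    · exact hA
    · rw [coeff_eq_zero_of_natDegree_lt h1, derivative_zero]
  have hq0 : q.natDegree = 0 := by
    by_cases hz : q = 0
    · rw [hz, natDegree_zero]
    · rw [hq, natDegree_mul hU hz, natDegree_dy] at hxdeg
      omega
  refine ⟨q.coeff 0, ?_⟩
  rw [hq, mul_comm, ← eq_C_of_natDegree_eq_zero hq0]

/-- In the situation of `exists_dx_eq_mul_dy`, `c` has constant derivative, `V` is determined by `U`
up to an affine function of `x`, and `h` is a quadratic polynomial in `U`. -/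
theorem exists_eq_of_dx_eq_mul_dy {U V h : K[X][X]} {c : K[X]} (hT : dx K U + dy K V = 0)
    (hN : dx K U ^ 2 + dy K U * dx K V + dy K h = 0) (hJ : dx K U * dy K h = dy K U * dx K h)
    (hU : dy K U ≠ 0) (hc : dx K U = C c * dy K U) :
    ∃ (e : K[X]) (γ ε k : K), derivative c = C γ ∧ derivative e = C ε ∧ V = C e - C c * U ∧
      2 * h = algebraMap K K[X][X] γ * U ^ 2 - 2 * algebraMap K K[X][X] ε * U
        + algebraMap K K[X][X] k := by
  have hdeg : U.natDegree ≠ 0 := fun h2 => hU (by rw [eq_C_of_natDegree_eq_zero h2, dy_C])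
  have hVy : dy K (V + C c * U) = 0 := by
    rw [map_add, Derivation.leibniz, dy_C, smul_eq_mul, smul_zero]
    linear_combination hT - hc
  obtain ⟨e, he⟩ : ∃ e, V + C c * U = C e := ⟨_, dy_eq_zero_iff.1 hVy⟩
  have hV : V = C e - C c * U := by linear_combination he
  have hVx : dx K V = C (derivative e) - C (derivative c) * U - C c * dx K U := by
    rw [hV, map_sub, Derivation.leibniz, dx_C, dx_C, smul_eq_mul, smul_eq_mul]; ring
  have hhy : dy K h = dy K U * (C (derivative c) * U - C (derivative e)) := by
    rw [hVx, hc] at hN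
    linear_combination hN
  have hhx : dx K h = C c * dy K h := by
    rw [hc] at hJ
    refine mul_left_cancel₀ hU ?_
    linear_combination -hJ
  have hxy : dx K (dy K U) = C c * dy K (dy K U) := by
    rw [dx_dy_comm, hc, Derivation.leibniz, dy_C]; simp
  -- This is the equality of the mixed derivatives of h: the field ∂/∂x - c ∂/∂y does not commute
  -- with ∂/∂x, but it kills U, U_y and h_y. Positive degree of U in y then gives c'' = e'' = 0.
  have h1 : dy K U * (C (derivative (derivative c)) * U - C (derivative (derivative e))) = 0 := by
    have h2 := dx_dy_comm h
    rw [hhx, Derivation.leibniz (dy K), dy_C, hhy] at h2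
    simp only [Derivation.leibniz, map_sub, dx_C, dy_C, smul_eq_mul, hxy, hc] at h2
    linear_combination h2
  have h2 := (mul_eq_zero.1 h1).resolve_left hU
  have h3 : derivative (derivative c) = 0 := by
    by_contra h0
    have h4 := congrArg (fun p => coeff p U.natDegree) h2
    simp only [coeff_sub, coeff_C_mul, coeff_C, if_neg hdeg, coeff_zero, coeff_natDegree,
      sub_zero] at h4
    rcases mul_eq_zero.1 h4 with h5 | h5
    · exact h0 h5
    · exact hU (by rw [leadingCoeff_eq_zero.1 h5, map_zero])
  rw [h3, C_0, zero_mul, zero_sub, neg_eq_zero, C_eq_zero] at h2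
  have hγ := eq_C_of_derivative_eq_zero h3
  have hε := eq_C_of_derivative_eq_zero h2
  set γ := (derivative c).coeff 0
  set ε := (derivative e).coeff 0
  rw [hγ, hε] at hhy
  have hγ' : C (C γ) = algebraMap K K[X][X] γ := rfl
  have hε' : C (C ε) = algebraMap K K[X][X] ε := rfl
  rw [hγ', hε'] at hhy
  have hD : ∀ D : Derivation K K[X][X] K[X][X],
      D (2 * h - (algebraMap K K[X][X] γ * U ^ 2 - 2 * algebraMap K K[X][X] ε * U)) =
      2 * (D h - D U * (algebraMap K K[X][X] γ * U - algebraMap K K[X][X] ε)) := by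
    intro D
    have h2 : D 2 = 0 := D.map_natCast 2
    simp only [map_sub, Derivation.leibniz, Derivation.leibniz_pow, Derivation.map_algebraMap, h2,
      smul_eq_mul, nsmul_eq_mul]
    push_cast
    ring
  obtain ⟨k, hk⟩ := exists_const
    (p := 2 * h - (algebraMap K K[X][X] γ * U ^ 2 - 2 * algebraMap K K[X][X] ε * U))
    (by rw [hD, hhx, hhy, hc]; ring) (by rw [hD, hhy]; ring)
  exact ⟨e, γ, ε, k, hγ, hε, hV, by linear_combination hk⟩

/-- Two plane polynomials with nilpotent Jacobian are linearly dependent modulo constants. -/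
theorem exists_linear_relation [IsAlgClosed K] {U V : K[X][X]} (hT : dx K U + dy K V = 0)
    (hJ : dx K U * dy K V = dy K U * dx K V) :
    ∃ a b e : K, (a ≠ 0 ∨ b ≠ 0) ∧
      algebraMap K K[X][X] a * U + algebraMap K K[X][X] b * V = algebraMap K K[X][X] e := by
  have hN : dx K U ^ 2 + dy K U * dx K V + dy K (0 : K[X][X]) = 0 := by
    rw [map_zero]; linear_combination dx K U * hT - hJ
  by_cases hU : dy K U = 0
  · have hx : dx K U = 0 := by
      rw [hU, zero_mul, add_zero, map_zero, add_zero] at hN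
      exact pow_eq_zero_iff two_ne_zero |>.1 hN
    obtain ⟨k, hk⟩ := exists_const hx hU
    exact ⟨1, 0, k, Or.inl one_ne_zero, by simp [hk]⟩
  · have hJ0 : dx K U * dy K (0 : K[X][X]) = dy K U * dx K 0 := by simp
    obtain ⟨c, hc⟩ := exists_dx_eq_mul_dy hT hN hJ0 hU
    obtain ⟨e, γ, ε, k, hγ, hε, hV, hh⟩ := exists_eq_of_dx_eq_mul_dy hT hN hJ0 hU hc
    have hdeg : U.natDegree ≠ 0 := fun h2 => hU (by rw [eq_C_of_natDegree_eq_zero h2, dy_C])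
    -- With h = 0 the quadratic relation for U has zero y-derivative, which forces γ = ε = 0, so c
    -- and e are constants.
    have hyy : algebraMap K K[X][X] γ * U - algebraMap K K[X][X] ε = 0 := by
      have h1 := congrArg (dy K) hh
      have h2 : dy K 2 = 0 := (dy K).map_natCast 2
      simp only [map_sub, map_add, Derivation.leibniz, Derivation.leibniz_pow,
        Derivation.map_algebraMap, h2, smul_eq_mul, nsmul_eq_mul, map_zero, mul_zero] at h1
      push_cast at h1
      have h3 : (2 * dy K U) * (algebraMap K K[X][X] γ * U - algebraMap K K[X][X] ε) = 0 := by
        linear_combination -h1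
      exact (mul_eq_zero.1 h3).resolve_left (mul_ne_zero two_ne_zero hU)
    have hγ0 : γ = 0 := by
      by_contra h0
      have h1 : algebraMap K K[X][X] γ * U = algebraMap K K[X][X] ε := by linear_combination hyy
      have h2 := congrArg natDegree h1
      rw [show algebraMap K K[X][X] γ = C (C γ) from rfl,
        show algebraMap K K[X][X] ε = C (C ε) from rfl, natDegree_C_mul (by simpa using h0),
        natDegree_C] at h2
      exact hdeg h2
    have hε0 : ε = 0 := by
      rw [hγ0, map_zero, zero_mul, zero_sub, neg_eq_zero] at hyy
      simpa using hyy
    rw [hγ0, C_0] at hγ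
    rw [hε0, C_0] at hε
    refine ⟨c.coeff 0, 1, e.coeff 0, Or.inr one_ne_zero, ?_⟩
    rw [hV, eq_C_of_derivative_eq_zero hγ, eq_C_of_derivative_eq_zero hε]
    simp only [coeff_C_zero, map_one, one_mul]
    rw [show algebraMap K K[X][X] (c.coeff 0) = C (C (c.coeff 0)) from rfl,
      show algebraMap K K[X][X] (e.coeff 0) = C (C (e.coeff 0)) from rfl]
    ring

end Plane

/-! ### The equations of the problem over R[z], for an abstract pair of derivations. -/

/-- The properties of the derivations `D = ∂/∂x` and `E = ∂/∂y` of `K[x, y]` used in the study of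
nilpotent Jacobians. -/
structure PlanePair {K R : Type*} [Field K] [CommRing R] [Algebra K R]
    (D E : Derivation K R R) : Prop where
  comm : ∀ a, D (E a) = E (D a)
  const : ∀ a, D a = 0 → E a = 0 → ∃ k : K, a = algebraMap K R k
  factor : ∀ a b, D (a * b) = 0 → a * b ≠ 0 → D a = 0
  sq : ∀ a, a ^ 2 ∣ E a ^ 2 → E a = 0
  rel : ∀ U V, D U + E V = 0 → D U * E V = E U * D V →
    ∃ a b e : K, (a ≠ 0 ∨ b ≠ 0) ∧ algebraMap K R a * U + algebraMap K R b * V = algebraMap K R e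

/-- The equations expressing that `(u(x, y, v), v, h)` has a nilpotent Jacobian matrix and
components which are linearly independent modulo constants, where `v` depends on `z`. -/
structure NilpotentTriple {K R : Type*} [Field K] [CommRing R] [Algebra K R]
    (D E : Derivation K R R) (u v : R[X]) (h : R) : Prop where
  trace : (D.coeffwise u).comp v + (derivative u).comp v * D.coeffwise v + E.coeffwise v = 0
  minors : (D.coeffwise u).comp v * E.coeffwise v - (E.coeffwise u).comp v * D.coeffwise v
    - derivative v * ((derivative u).comp v * C (D h) + C (E h)) = 0
  jac : D.coeffwise u * C (E h) = E.coeffwise u * C (D h)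
  deriv_ne : derivative v ≠ 0
  indep : ∀ a b c e : K, C (algebraMap K R a) * u.comp v + C (algebraMap K R b) * v
    + C (algebraMap K R c * h) = C (algebraMap K R e) → a = 0 ∧ b = 0 ∧ c = 0

/-! ### Comparison of degrees and coefficients in z. -/

namespace NilpotentTriple

variable {K R : Type*} [Field K] [CommRing R] [Algebra K R]
  {D E : Derivation K R R} {u v : R[X]} {h : R}


theorem exists_natDegree (H : NilpotentTriple D E u v h) : ∃ d, v.natDegree = d + 1 :=
  ⟨v.natDegree - 1, by
    have : v.natDegree ≠ 0 := fun h0 => H.deriv_ne (by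
      rw [eq_C_of_natDegree_eq_zero h0, derivative_C])
    omega⟩

theorem h_ne_const (H : NilpotentTriple D E u v h) (k : K) : h ≠ algebraMap K R k := by
  rintro rfl
  have := H.indep 0 0 1 k (by simp)
  exact one_ne_zero this.2.2


variable [IsDomain R] [CharZero R]

/-- The function `h` depends on `x`. -/
theorem dx_ne_zero (P : PlanePair D E) (H : NilpotentTriple D E u v h) : D h ≠ 0 := by
  intro hx
  obtain ⟨d, hd⟩ := H.exists_natDegree
  have hEh : E h ≠ 0 := fun h0 => by
    obtain ⟨k, hk⟩ := P.const h hx h0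
    exact H.h_ne_const k hk
  have hCE : (C (E h) : R[X]) ≠ 0 := C_ne_zero.2 hEh
  have hux : D.coeffwise u = 0 := by
    have := H.jac
    rw [hx, C_0, mul_zero] at this
    exact (mul_eq_zero.1 this).resolve_right hCE
  have hN : (E.coeffwise u).comp v * D.coeffwise v = - (derivative v * C (E h)) := by
    have := H.minors
    rw [hux, hx, C_0] at this
    simp only [zero_comp] at this
    linear_combination -this
  have hT : (derivative u).comp v * D.coeffwise v + E.coeffwise v = 0 := by
    have := H.trace
    rwa [hux, zero_comp, zero_add] at this
  have hne : (E.coeffwise u).comp v * D.coeffwise v ≠ 0 := by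
    rw [hN]; exact neg_ne_zero.2 (mul_ne_zero H.deriv_ne hCE)
  have hvx0 : D.coeffwise v ≠ 0 := right_ne_zero_of_mul hne
  have hdeg := congrArg natDegree hN
  rw [natDegree_neg, natDegree_mul (left_ne_zero_of_mul hne) hvx0, natDegree_comp,
    natDegree_mul_C hEh, natDegree_derivative, hd, Nat.add_sub_cancel] at hdeg
  -- The degree equation reads deg(u_y)·(d+1) + deg(v_x) = d, so u_y is free of z and v_x has degree
  -- d.
  have hk : (E.coeffwise u).natDegree = 0 := by
    by_contra h0
    have := Nat.le_mul_of_pos_left (d + 1) (Nat.pos_of_ne_zero h0)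
    omega
  have hvxd : (D.coeffwise v).natDegree = d := by rw [hk] at hdeg; omega
  obtain ⟨r, hr⟩ : ∃ r, E.coeffwise u = C r := ⟨_, eq_C_of_natDegree_eq_zero hk⟩
  have hr' : r = E (u.coeff 0) := by
    have := congrArg (fun p => coeff p 0) hr
    simpa using this.symm
  have hr0 : r ≠ 0 := by
    rintro rfl
    rw [hr] at hne
    simp at hne
  have hcoef : ∀ j, r * D (v.coeff j) + v.coeff (j + 1) * (j + 1) * E h = 0 := by
    intro j
    have := congrArg (fun p => coeff p j) hN
    rw [hr, C_comp] at this
    simp only [coeff_C_mul, coeff_neg, coeff_mul_C, coeff_derivative,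
      Derivation.coeff_coeffwise] at this
    linear_combination this
  set β := v.coeff (d + 1) with hβ
  have hβ0 : β ≠ 0 := by
    rw [hβ, ← hd, coeff_natDegree]
    refine leadingCoeff_ne_zero.2 fun h0 => H.deriv_ne (by rw [h0, derivative_zero])
  set σ := D (v.coeff d) with hσ
  have hσr : r * σ + β * (d + 1) * E h = 0 := hcoef d
  have hd1 : (d : R) + 1 ≠ 0 := by exact_mod_cast Nat.succ_ne_zero d
  have hσ0 : σ ≠ 0 := by
    intro h0
    rw [h0, mul_zero, zero_add] at hσr
    exact mul_ne_zero (mul_ne_zero hβ0 hd1) hEh hσr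
  have hm : (derivative u).natDegree * (d + 1) ≤ 1 := by
    by_cases hu0 : derivative u = 0
    · simp [hu0]
    · have h1 : (derivative u).comp v ≠ 0 := fun h0 => by
        rcases comp_eq_zero_iff.1 h0 with h2 | h2
        · exact hu0 h2
        · have := congrArg natDegree h2.2
          rw [hd, natDegree_C] at this
          omega
      have h2 := congrArg natDegree (eq_neg_of_add_eq_zero_left hT)
      rw [natDegree_neg, natDegree_mul h1 hvx0, natDegree_comp, hvxd, hd] at h2
      have h3 := E.natDegree_coeffwise_le v
      omega
  by_cases hm0 : (derivative u).natDegree = 0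
  · obtain ⟨w, hw⟩ : ∃ w, derivative u = C w := ⟨_, eq_C_of_natDegree_eq_zero hm0⟩
    have hw1 : w = u.coeff 1 := by
      have := congrArg (fun p => coeff p 0) hw
      simpa [coeff_derivative] using this.symm
    have hDw : D w = 0 := by
      rw [hw1, ← Derivation.coeff_coeffwise, hux, coeff_zero]
    have hEw : E w = 0 := by
      rw [hw1, ← Derivation.coeff_coeffwise, hr, coeff_C, if_neg one_ne_zero]
    obtain ⟨w₀, hw₀⟩ := P.const w hDw hEw
    have hTc : ∀ j, w * D (v.coeff j) + E (v.coeff j) = 0 := by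
      intro j
      have := congrArg (fun p => coeff p j) hT
      rw [hw, C_comp] at this
      simpa using this
    have hDβ : D β = 0 := by
      have := hcoef (d + 1)
      rw [coeff_eq_zero_of_natDegree_lt (p := v) (n := d + 1 + 1) (by omega), zero_mul, zero_mul,
        add_zero] at this
      exact (mul_eq_zero.1 this).resolve_left hr0
    have hEβ : E β = 0 := by
      have := hTc (d + 1)
      rwa [← hβ, hDβ, mul_zero, zero_add] at this
    have hDr : D r = 0 := by
      rw [hr', P.comm, ← Derivation.coeff_coeffwise, hux, coeff_zero, map_zero]
    have hDσ : D σ = 0 := by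
      have h1 := congrArg D hσr
      have h2 : D ((d : R) + 1) = 0 := by
        rw [← Nat.cast_succ]; exact D.map_natCast _
      simp only [map_add, Derivation.leibniz, hDr, hDβ, P.comm h, hx, h2, smul_eq_mul,
        map_zero, mul_zero, add_zero] at h1
      exact (mul_eq_zero.1 h1).resolve_left hr0
    have hEσ : E σ = 0 := by
      have h1 := congrArg D (hTc d)
      rw [← hσ, map_add, Derivation.leibniz, hDw, hDσ, P.comm, ← hσ] at h1
      simpa using h1
    obtain ⟨s, hs⟩ := P.const σ hDσ hEσ
    obtain ⟨t, ht⟩ := P.const β hDβ hEβ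
    -- Since r = E (u.coeff 0), the relation `hσr` says that this combination has zero y-derivative;
    -- its x-derivative vanishes as u_x = h_x = 0. It becomes a forbidden linear relation between
    -- the three components.
    obtain ⟨q, hq⟩ := P.const (algebraMap K R s * u.coeff 0 + algebraMap K R (t * (d + 1)) * h)
      (by
        have : D (u.coeff 0) = 0 := by rw [← Derivation.coeff_coeffwise, hux, coeff_zero]
        simp [Derivation.leibniz, this, hx])
      (by
        rw [map_add, Derivation.leibniz, Derivation.leibniz, Derivation.map_algebraMap,
          Derivation.map_algebraMap, ← hr', ← hs, map_mul, ← ht]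
        simp only [smul_eq_mul, mul_zero, add_zero, map_add, map_natCast, map_one]
        linear_combination hσr)
    have hu : u = C (algebraMap K R w₀) * X + C (u.coeff 0) := by
      have h1 : u.natDegree ≤ 1 := by
        rw [natDegree_derivative] at hm0; omega
      conv_lhs => rw [eq_X_add_C_of_natDegree_le_one h1]
      rw [← hw1, ← hw₀]
    have := H.indep s (-(s * w₀)) (t * (d + 1)) q (by
      rw [hu, ← hq]
      simp only [add_comp, mul_comp, C_comp, X_comp, map_neg, map_mul, map_add]
      ring)
    rw [this.1, map_zero] at hs
    exact hσ0 hs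
  · have hd0 : d = 0 := by
      by_contra h0
      have := Nat.le_mul_of_pos_left (d + 1) (Nat.pos_of_ne_zero hm0)
      omega
    subst hd0
    obtain ⟨w, hw⟩ : ∃ w, derivative u = C ((derivative u).coeff 1) * X + C w :=
      ⟨_, eq_X_add_C_of_natDegree_le_one (by omega)⟩
    have hw1 : (derivative u).coeff 1 ≠ 0 := by
      have h1 : (derivative u).natDegree = 1 := by omega
      rw [← h1, coeff_natDegree]
      exact leadingCoeff_ne_zero.2 fun h0 => hm0 (by rw [h0, natDegree_zero])
    set w1 := (derivative u).coeff 1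
    have hvx : D.coeffwise v = C σ := by
      rw [eq_C_of_natDegree_eq_zero hvxd, Derivation.coeff_coeffwise]
    have h1 := congrArg (fun p => coeff p 1) hT
    rw [hw, hvx] at h1
    simp only [add_comp, mul_comp, C_comp, X_comp, coeff_add, coeff_mul_C, coeff_C_mul,
      coeff_C, if_neg one_ne_zero, Derivation.coeff_coeffwise, coeff_zero] at h1
    have hv1 : v.coeff 1 = β := rfl
    rw [hv1] at h1
    -- The coefficient of z in the trace gives E β = -w1·β·σ, so β divides E β, which must vanish;
    -- but w1, β and σ are nonzero.
    have h2 : E β = 0 := P.sq β ⟨(w1 * σ) ^ 2, by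
      rw [show E β = -(w1 * β * σ) by linear_combination h1]; ring⟩
    rw [h2, add_zero, add_zero] at h1
    exact mul_ne_zero (mul_ne_zero hw1 hβ0) hσ0 h1

/-- If `u` has degree at most one in its last variable, then its leading coefficient is constant. -/
theorem coeff_one_eq_const (P : PlanePair D E) (H : NilpotentTriple D E u v h)
    (hu : u.natDegree ≤ 1) : ∃ k : K, u.coeff 1 = algebraMap K R k := by
  have hDh := H.dx_ne_zero P
  obtain ⟨d, hd⟩ := H.exists_natDegree
  set w := u.coeff 1 with hw
  set U := u.coeff 0 with hU
  have hu' : u = C w * X + C U := eq_X_add_C_of_natDegree_le_one hu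
  set β := v.coeff (d + 1) with hβ
  have hβ0 : β ≠ 0 := by
    rw [hβ, ← hd, coeff_natDegree]
    refine leadingCoeff_ne_zero.2 fun h0 => H.deriv_ne (by rw [h0, derivative_zero])
  have hcw : ∀ F : Derivation K R R, F.coeffwise u = C (F w) * X + C (F U) := fun F => by
    rw [hu', map_add, Derivation.leibniz, F.coeffwise_C, F.coeffwise_C, F.coeffwise_X]
    simp only [smul_eq_mul]; ring
  have hu1 : derivative u = C w := by rw [hu']; simp
  have hT := congrArg (fun p => coeff p (d + 1)) H.trace
  have hN := congrArg (fun p => coeff p ((d + 1) + (d + 1))) H.minors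
  rw [hcw, hu1] at hT
  rw [hcw, hcw, hu1] at hN
  simp only [add_comp, mul_comp, C_comp, X_comp, coeff_add, coeff_C_mul, coeff_C,
    if_neg (Nat.succ_ne_zero d), Derivation.coeff_coeffwise, coeff_zero, add_zero, ← hβ] at hT
  simp only [add_comp, mul_comp, C_comp, X_comp, coeff_sub, coeff_zero] at hN
  have hlin : ∀ a b : R, (C a * v + C b).natDegree ≤ d + 1 := fun a b =>
    natDegree_add_le_of_degree_le ((natDegree_C_mul_le a v).trans hd.le) (by simp)
  rw [coeff_mul_add_eq_of_natDegree_le (hlin _ _) ((E.natDegree_coeffwise_le v).trans hd.le),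
    coeff_mul_add_eq_of_natDegree_le (hlin _ _) ((D.natDegree_coeffwise_le v).trans hd.le),
    coeff_eq_zero_of_natDegree_lt (p := derivative v * _) (by
      rw [← C_mul, ← C_add]
      refine lt_of_le_of_lt (natDegree_mul_C_le _ _) ?_
      rw [natDegree_derivative, hd]; omega)] at hN
  simp only [coeff_add, coeff_C_mul, coeff_C, if_neg (Nat.succ_ne_zero d), add_zero, sub_zero,
    Derivation.coeff_coeffwise, ← hβ] at hN
  -- The top coefficients in z of the trace and minor equations say that the plane map (wβ, β) has
  -- nilpotent Jacobian.
  obtain ⟨a, b, e, hab, he⟩ := P.rel (w * β) β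
    (by rw [Derivation.leibniz, smul_eq_mul, smul_eq_mul]; linear_combination hT)
    (by
      rw [Derivation.leibniz, Derivation.leibniz]
      simp only [smul_eq_mul]
      linear_combination hN)
  have hfac : β * (algebraMap K R a * w + algebraMap K R b) = algebraMap K R e := by
    linear_combination he
  have hinj := (algebraMap K R).injective
  by_cases he0 : e = 0
  · rw [he0, map_zero] at hfac
    have h1 := (mul_eq_zero.1 hfac).resolve_left hβ0
    have ha : a ≠ 0 := by
      rintro rfl
      rw [map_zero, zero_mul, zero_add] at h1
      have : b = 0 := hinj (by rw [h1, map_zero])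
      simp [this] at hab
    refine ⟨-b / a, ?_⟩
    have h2 : algebraMap K R a ≠ 0 := fun h0 => ha (hinj (by rw [h0, map_zero]))
    refine mul_left_cancel₀ h2 ?_
    rw [← map_mul, mul_div_cancel₀ _ ha, map_neg]
    linear_combination h1
  · have hDβ : D β = 0 := by
      refine P.factor β _ (by rw [hfac]; exact D.map_algebraMap e) ?_
      rw [hfac]
      exact fun h0 => he0 (hinj (by rw [h0, map_zero]))
    rw [hDβ, mul_zero, add_zero] at hT
    have hEβ : E β = 0 := P.sq β ⟨(D w) ^ 2, by
      rw [show E β = -(D w * β) by linear_combination hT]; ring⟩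
    rw [hEβ, add_zero] at hT
    have hDw := (mul_eq_zero.1 hT).resolve_right hβ0
    have hj := congrArg (fun p => coeff p 1) H.jac
    simp only [coeff_mul_C, Derivation.coeff_coeffwise, ← hw, hDw, zero_mul] at hj
    have hEw := (mul_eq_zero.1 hj.symm).resolve_right hDh
    exact P.const w hDw hEw

end NilpotentTriple

/-! ### The first component has degree at most one in z. -/

theorem Polynomial.exists_eq_C_mul_X_pow_add {R : Type*} [Ring R] {p : R[X]} {m : ℕ}
    (hp : p.natDegree ≤ m + 1) :
    ∃ a : R[X], a.natDegree ≤ m ∧ p = C (p.coeff (m + 1)) * X ^ (m + 1) + a := by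
  refine ⟨p - C (p.coeff (m + 1)) * X ^ (m + 1), ?_, by abel⟩
  refine natDegree_le_iff_coeff_eq_zero.2 fun n hn => ?_
  rw [coeff_sub, coeff_C_mul_X_pow]
  split_ifs with h
  · rw [h, sub_self]
  · rw [coeff_eq_zero_of_natDegree_lt (by omega), sub_zero]

namespace NilpotentTriple

variable {K R : Type*} [Field K] [CommRing R] [Algebra K R]
  {D E : Derivation K R R} {u v : R[X]} {h : R} [IsDomain R] [CharZero R]

/-- If `u` has degree `m + 2 ≥ 2` in its last variable, then its leading coefficient is constant,
and the part of `v` which depends on `x` is a multiple of the next coefficient of `u`. -/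
theorem dx_eq_of_two_le (P : PlanePair D E) (H : NilpotentTriple D E u v h) {m : ℕ}
    (hu : u.natDegree = m + 2) :
    ∃ k : K, k ≠ 0 ∧ u.leadingCoeff = algebraMap K R k ∧
      C (((m : R) + 2) * algebraMap K R k) * D.coeffwise v + C (D (u.coeff (m + 1))) = 0 := by
  have hDh := H.dx_ne_zero P
  obtain ⟨d, hd⟩ := H.exists_natDegree
  have hu0 : u ≠ 0 := fun h0 => by rw [h0, natDegree_zero] at hu; omega
  have hv0 : v ≠ 0 := fun h0 => H.deriv_ne (by rw [h0, derivative_zero])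
  have hlu : u.leadingCoeff ≠ 0 := leadingCoeff_ne_zero.2 hu0
  have hlv : v.leadingCoeff ≠ 0 := leadingCoeff_ne_zero.2 hv0
  have hvy : (E.coeffwise v).natDegree ≤ d + 1 := (E.natDegree_coeffwise_le v).trans hd.le
  -- By the trace, D(u(v)) = -E v has degree at most d+1 in z, below the degree (m+2)(d+1) where the
  -- leading coefficient of u(v) sits.
  have hDl : D u.leadingCoeff = 0 := by
    refine P.factor _ (v.leadingCoeff ^ u.natDegree) ?_ (mul_ne_zero hlu (pow_ne_zero _ hlv))
    · have h1 : D.coeffwise (u.comp v) = - E.coeffwise v := by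
        rw [D.coeffwise_comp]; linear_combination H.trace
      have h2 := congrArg (fun p => coeff p (u.natDegree * v.natDegree)) h1
      simp only [Derivation.coeff_coeffwise, coeff_neg] at h2
      rw [coeff_comp_degree_mul_degree (by omega), ← Derivation.coeff_coeffwise,
        coeff_eq_zero_of_natDegree_lt (p := E.coeffwise v), neg_zero] at h2
      · exact h2
      · rw [hu, hd]
        nlinarith
  have hEl : E u.leadingCoeff = 0 := by
    have hj := congrArg (fun p => coeff p u.natDegree) H.jac
    simp only [coeff_mul_C, Derivation.coeff_coeffwise, coeff_natDegree, hDl, zero_mul] at hj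
    exact (mul_eq_zero.1 hj.symm).resolve_right hDh
  obtain ⟨k, hk⟩ := P.const _ hDl hEl
  have hk0 : k ≠ 0 := by
    rintro rfl
    exact hlu (by rw [hk, map_zero])
  refine ⟨k, hk0, hk, ?_⟩
  have hm2 : (m : R) + 2 ≠ 0 := by exact_mod_cast Nat.succ_ne_zero (m + 1)
  set c : R := ((m : R) + 2) * algebraMap K R k with hc
  have hc0 : c ≠ 0 := mul_ne_zero hm2 (hk ▸ hlu)
  set τ : R[X] := C c * D.coeffwise v + C (D (u.coeff (m + 1))) with hτ
  have hcoe : u.coeff (m + 2) = algebraMap K R k := by rw [← hk, leadingCoeff, hu]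
  obtain ⟨a, ha, hua⟩ := exists_eq_C_mul_X_pow_add (p := D.coeffwise u) (m := m) (by
    refine natDegree_le_iff_coeff_eq_zero.2 fun n hn => ?_
    rw [Derivation.coeff_coeffwise]
    rcases (show n = m + 2 ∨ m + 2 < n by omega) with rfl | h1
    · rw [hcoe, Derivation.map_algebraMap]
    · rw [coeff_eq_zero_of_natDegree_lt (by omega), map_zero])
  obtain ⟨b, hb, hub⟩ := exists_eq_C_mul_X_pow_add (p := derivative u) (m := m) (by
    rw [natDegree_derivative]; omega)
  rw [Derivation.coeff_coeffwise] at hua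
  rw [coeff_derivative, show m + 1 + 1 = m + 2 by ring, hcoe,
    show algebraMap K R k * (((m + 1 : ℕ) : R) + 1) = c by push_cast; rw [hc]; ring] at hub
  -- This isolates the power v^(m+1) in the trace. If τ ≠ 0, then deg v_x ≤ deg τ, and degrees force
  -- m = 0 and deg τ = 0; the top coefficient then gives τ = 0 after all.
  have heq : v ^ (m + 1) * τ = -(a.comp v + b.comp v * D.coeffwise v + E.coeffwise v) := by
    have := H.trace
    rw [hua, hub] at this
    simp only [add_comp, mul_comp, C_comp, X_pow_comp] at this
    rw [hτ]
    linear_combination this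
  by_contra hτ0
  have hvx : (D.coeffwise v).natDegree ≤ τ.natDegree := by
    have h1 : C c * D.coeffwise v = τ - C (D (u.coeff (m + 1))) := by rw [hτ]; ring
    rw [← natDegree_C_mul (p := D.coeffwise v) hc0, h1]
    exact (natDegree_sub_C (p := τ)).le
  have hav : (a.comp v).natDegree ≤ m * (d + 1) := by
    rw [natDegree_comp, hd]
    exact Nat.mul_le_mul_right _ ha
  have hbv : (b.comp v * D.coeffwise v).natDegree ≤ m * (d + 1) + τ.natDegree := by
    refine natDegree_mul_le_of_le ?_ hvx
    rw [natDegree_comp, hd]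
    exact Nat.mul_le_mul_right _ hb
  have hdeg := congrArg natDegree heq
  rw [natDegree_mul (pow_ne_zero _ hv0) hτ0, natDegree_pow, hd, natDegree_neg] at hdeg
  have hle : (m + 1) * (d + 1) + τ.natDegree ≤ d + 1 := by
    have h1 := natDegree_add_le (a.comp v + b.comp v * D.coeffwise v) (E.coeffwise v)
    have h2 := natDegree_add_le (a.comp v) (b.comp v * D.coeffwise v)
    have h3 : (m + 1) * (d + 1) = m * (d + 1) + (d + 1) := by ring
    omega
  have hm0 : m = 0 := by
    by_contra h0
    have := Nat.le_mul_of_pos_left (d + 1) (Nat.pos_of_ne_zero h0)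
    have h3 : (m + 1) * (d + 1) = m * (d + 1) + (d + 1) := by ring
    omega
  subst hm0
  have ht0 : τ.natDegree = 0 := by omega
  have h1 := congrArg (fun p => coeff p (d + 1)) heq
  rw [eq_C_of_natDegree_eq_zero ht0] at h1
  simp only [zero_add, pow_one, coeff_mul_C, coeff_neg, coeff_add] at h1
  rw [coeff_eq_zero_of_natDegree_lt (p := a.comp v) (by omega),
    coeff_eq_zero_of_natDegree_lt (p := b.comp v * _) (by omega), Derivation.coeff_coeffwise,
    zero_add, zero_add] at h1
  have hlv' : v.coeff (d + 1) ≠ 0 := by rwa [← hd, coeff_natDegree]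
  have hE : E (v.coeff (d + 1)) = 0 := P.sq _ ⟨τ.coeff 0 ^ 2, by
    rw [show E (v.coeff (d + 1)) = -(v.coeff (d + 1) * τ.coeff 0) by rw [h1, neg_neg]]
    ring⟩
  rw [hE, neg_zero] at h1
  have h2 := (mul_eq_zero.1 h1).resolve_left hlv'
  exact hτ0 (by rw [eq_C_of_natDegree_eq_zero ht0, h2, C_0])

/-- `u` has degree at most one in its last variable. -/
theorem natDegree_le_one (P : PlanePair D E) (H : NilpotentTriple D E u v h) :
    u.natDegree ≤ 1 := by
  by_contra! hlt
  obtain ⟨m, hu⟩ : ∃ m, u.natDegree = m + 2 := ⟨u.natDegree - 2, by omega⟩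
  obtain ⟨k, hk0, hk, hτ⟩ := H.dx_eq_of_two_le P hu
  have hDh := H.dx_ne_zero P
  obtain ⟨d, hd⟩ := H.exists_natDegree
  have hinj := (algebraMap K R).injective
  have hm2 : (m : R) + 2 ≠ 0 := by exact_mod_cast Nat.succ_ne_zero (m + 1)
  have hk0' : algebraMap K R k ≠ 0 := fun h0 => hk0 (hinj (by rw [h0, map_zero]))
  set c : K := ((m : K) + 2) * k with hc
  have hcR : algebraMap K R c = ((m : R) + 2) * algebraMap K R k := by
    rw [hc, map_mul, map_add, map_natCast, map_ofNat]
  have hcR0 : algebraMap K R c ≠ 0 := hcR ▸ mul_ne_zero hm2 hk0'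
  have hc0 : c ≠ 0 := fun h0 => hcR0 (by rw [h0, map_zero])
  -- Q is normalized so that `dx_eq_of_two_le` becomes v_x = Q_x; in particular v_x is free of z.
  obtain ⟨Q, hQ⟩ : ∃ Q : R, u.coeff (m + 1) = -(algebraMap K R c * Q) :=
    ⟨-(algebraMap K R c⁻¹ * u.coeff (m + 1)), by
      rw [mul_neg, neg_neg, ← mul_assoc, ← map_mul, mul_inv_cancel₀ hc0, map_one, one_mul]⟩
  have hFQ : ∀ F : Derivation K R R, F (u.coeff (m + 1)) = -(algebraMap K R c * F Q) := fun F => by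
    rw [hQ, map_neg, Derivation.leibniz, Derivation.map_algebraMap]; simp
  have hvx : D.coeffwise v = C (D Q) := by
    refine mul_left_cancel₀ (C_ne_zero.2 hcR0) ?_
    rw [← hcR, hFQ, C_neg, C_mul] at hτ
    linear_combination hτ
  have hQJ : D Q * E h = E Q * D h := by
    have hj := congrArg (fun p => coeff p (m + 1)) H.jac
    simp only [coeff_mul_C, Derivation.coeff_coeffwise, hFQ] at hj
    refine mul_left_cancel₀ hcR0 ?_
    linear_combination -hj
  have huQ : D.coeffwise u * C (E Q) = E.coeffwise u * C (D Q) := by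
    refine mul_left_cancel₀ (C_ne_zero.2 hDh) ?_
    have h1 : (C (D Q) * C (E h) : R[X]) = C (E Q) * C (D h) := by
      rw [← C_mul, ← C_mul, hQJ]
    linear_combination (C (D Q)) * H.jac - D.coeffwise u * h1
  have huQ' : (D.coeffwise u).comp v * C (E Q) = (E.coeffwise u).comp v * C (D Q) := by
    have := congrArg (fun p => p.comp v) huQ
    simpa using this
  set W := (derivative u).comp v with hW
  have hN : (D.coeffwise u).comp v * (E.coeffwise v - C (E Q)) =
      derivative v * (W * C (D h) + C (E h)) := by
    have := H.minors
    rw [hvx] at this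
    linear_combination this - huQ'
  have hu'd : (derivative u).natDegree = m + 1 := by rw [natDegree_derivative, hu]; rfl
  have hWd : W.natDegree = (m + 1) * (d + 1) := by rw [hW, natDegree_comp, hu'd, hd]
  have hRd : (W * C (D h) + C (E h)).natDegree = (m + 1) * (d + 1) := by
    rw [natDegree_add_C, natDegree_mul_C hDh, hWd]
  have hR0 : W * C (D h) + C (E h) ≠ 0 := fun h0 => by
    rw [h0, natDegree_zero] at hRd
    have : 0 < (m + 1) * (d + 1) := by positivity
    omega
  have hNd := congrArg natDegree hN
  have hN0 : (D.coeffwise u).comp v * (E.coeffwise v - C (E Q)) ≠ 0 := by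
    rw [hN]; exact mul_ne_zero H.deriv_ne hR0
  have hy0 := right_ne_zero_of_mul hN0
  rw [natDegree_mul (left_ne_zero_of_mul hN0) hy0, natDegree_mul H.deriv_ne hR0, hRd,
    natDegree_derivative, hd, natDegree_comp, hd, natDegree_sub_C, Nat.add_sub_cancel] at hNd
  have hvyd : (E.coeffwise v).natDegree ≤ d + 1 := (E.natDegree_coeffwise_le v).trans hd.le
  have hT := H.trace
  rw [← hW, hvx] at hT
  by_cases hDQ : D Q = 0
  · have hEQ : E Q = 0 := by
      rw [hDQ, zero_mul] at hQJ
      exact (mul_eq_zero.1 hQJ.symm).resolve_right hDh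
    rw [hDQ, C_0, mul_zero, add_zero] at hT
    have hux : (D.coeffwise u).comp v = - E.coeffwise v := by linear_combination hT
    have hkd := congrArg natDegree hux
    rw [natDegree_neg, natDegree_comp, hd] at hkd
    -- With k = deg u_x in z, the degrees give 2k(d+1) + 1 = (m+2)(d+1), so d+1 divides 1.
    have hd0 : d = 0 := by
      have h1 : (d + 1) ∣ 2 * ((D.coeffwise u).natDegree * (d + 1)) :=
        Dvd.intro_left _ (by ring : 2 * (D.coeffwise u).natDegree * (d + 1) = _)
      have h2 : 2 * ((D.coeffwise u).natDegree * (d + 1)) + 1 = (m + 2) * (d + 1) := by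
        have : (m + 2) * (d + 1) = (m + 1) * (d + 1) + (d + 1) := by ring
        omega
      have h3 := (Nat.dvd_add_right h1).1 (h2 ▸ Dvd.intro_left _ rfl)
      have := Nat.le_of_dvd one_pos h3
      omega
    subst hd0
    have hm1 : m = 1 := by omega
    subst hm1
    rw [hux, hEQ, C_0, sub_zero] at hN
    have h1 := congrArg (fun p => coeff p (0 + (1 + 1))) hN
    have hv' : derivative v = C (v.coeff 1) := by
      rw [eq_C_of_natDegree_eq_zero (p := derivative v) (by rw [natDegree_derivative, hd]),
        coeff_derivative]
      simp
    have hWc : W.coeff 2 = 3 * algebraMap K R k * v.coeff 1 ^ 2 := by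
      have h2 := coeff_comp_degree_mul_degree (p := derivative u) (q := v) (by omega)
      rw [hu'd, hd, leadingCoeff, leadingCoeff, hu'd, hd, coeff_derivative] at h2
      have h3 : u.coeff (1 + 1 + 1) = algebraMap K R k := by rw [← hk, leadingCoeff, hu]
      rw [h3] at h2
      rw [hW]
      refine h2.trans ?_
      push_cast
      ring
    simp only [hv', zero_add, coeff_C_mul, neg_mul, coeff_neg, coeff_add, coeff_mul_C] at h1
    rw [coeff_mul_add_eq_of_natDegree_le hvyd hvyd, hWc, coeff_C,
      if_neg (by norm_num), Derivation.coeff_coeffwise] at h1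
    have hv1 : v.coeff 1 ≠ 0 := fun h0 => H.deriv_ne (by rw [hv', h0, C_0])
    -- The coefficient of z² in the minor equation makes (E β)² a multiple of β², for β = `v.coeff
    -- 1`.
    have hEv : E (v.coeff 1) = 0 :=
      P.sq _ ⟨-(3 * algebraMap K R k * v.coeff 1 * D h), by linear_combination -h1⟩
    rw [zero_add, hEv] at h1
    have h4 : v.coeff 1 * (3 * algebraMap K R k * v.coeff 1 ^ 2 * D h) ≠ 0 :=
      mul_ne_zero hv1 (mul_ne_zero (mul_ne_zero (mul_ne_zero (by norm_num) hk0')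
        (pow_ne_zero _ hv1)) hDh)
    exact h4 (by linear_combination -h1)
  -- The trace reads q(v) = -v_y, so deg q ≤ 1; the coefficients of degree m+1 cancel, so u_x
  -- inherits its degree from Q_x·u_z.
  · set q : R[X] := D.coeffwise u + C (D Q) * derivative u with hq
    have hqv : q.comp v = - E.coeffwise v := by
      rw [hq, add_comp, mul_comp, C_comp]
      linear_combination hT
    have hqd := congrArg natDegree hqv
    rw [natDegree_comp, natDegree_neg, hd] at hqd
    have hq1 : q.natDegree ≤ 1 := by
      by_contra! h0
      have := Nat.mul_le_mul_right (d + 1) h0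
      omega
    have hqc : q.coeff (m + 1) = 0 := by
      rw [hq, coeff_add, coeff_C_mul, coeff_derivative, Derivation.coeff_coeffwise, hFQ,
        show m + 1 + 1 = u.natDegree by omega, coeff_natDegree, hk, hcR]
      push_cast
      ring
    have hqm : q.natDegree ≤ m := by
      refine natDegree_le_iff_coeff_eq_zero.2 fun n hn => ?_
      rcases (show n = m + 1 ∨ m + 1 < n by omega) with rfl | h1
      · exact hqc
      · exact coeff_eq_zero_of_natDegree_lt (by omega)
    have hux : D.coeffwise u = q - C (D Q) * derivative u := by rw [hq]; ring
    have huxd : (D.coeffwise u).natDegree = m + 1 := by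
      rw [hux, natDegree_sub_eq_right_of_natDegree_lt, natDegree_C_mul hDQ, hu'd]
      rw [natDegree_C_mul hDQ, hu'd]
      omega
    rw [huxd] at hNd
    have hq0 : q.natDegree = 0 := by
      by_contra h0
      have := Nat.le_mul_of_pos_left (d + 1) (Nat.pos_of_ne_zero h0)
      omega
    have hd0 : d = 0 := by rw [hq0] at hqd; omega
    subst hd0
    obtain ⟨q₀, hq₀⟩ : ∃ q₀, q = C q₀ := ⟨_, eq_C_of_natDegree_eq_zero hq0⟩
    rw [hq₀, C_comp] at hqv
    have hvy : E.coeffwise v = C (-q₀) := by rw [C_neg]; linear_combination hqv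
    have hv' : ∃ β, derivative v = C β :=
      ⟨_, eq_C_of_natDegree_eq_zero (by rw [natDegree_derivative, hd])⟩
    obtain ⟨β, hβ⟩ := hv'
    have hβ0 : β ≠ 0 := fun h0 => H.deriv_ne (by rw [hβ, h0, C_0])
    rw [hvy, ← C_sub] at hy0 hN
    set s := -q₀ - E Q with hs
    have hs0 : s ≠ 0 := C_ne_zero.1 hy0
    rw [hux, hq₀, sub_comp, mul_comp, C_comp, C_comp, ← hW, hβ] at hN
    -- The minor equation is now affine in W = u_z(v), which has positive degree in z, so both
    -- coefficients vanish. Together with Q_x h_y = Q_y h_x they give Q_x s² = 0.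
    have hlin : W * C (D Q * s + β * D h) = C (q₀ * s - β * E h) := by
      simp only [C_add, C_sub, C_mul]
      linear_combination -hN
    have h1 : D Q * s + β * D h = 0 := by
      by_contra h0
      have h2 := congrArg natDegree hlin
      rw [natDegree_mul_C h0, hWd, natDegree_C] at h2
      omega
    rw [h1, C_0, mul_zero] at hlin
    have h2 : q₀ * s - β * E h = 0 := C_eq_zero.1 hlin.symm
    have h3 : D Q * s * s = 0 := by
      linear_combination D Q * s * hs - D Q * h2 - β * hQJ - E Q * h1
    exact mul_ne_zero (mul_ne_zero hDQ hs0) hs0 h3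

/-! ### First component free of z: reduction to the plane system. -/

/-- If `u` does not depend on its last variable, then `v` is affine in `z` with constant slope. -/
theorem exists_eq_add_C_mul_X {U : R} (P : PlanePair D E) (H : NilpotentTriple D E (C U) v h) :
    E U ≠ 0 ∧ ∃ (V : R) (t : K), t ≠ 0 ∧ v = C V + C (algebraMap K R t) * X ∧ D U + E V = 0 ∧
      D U ^ 2 + E U * D V + algebraMap K R t * E h = 0 ∧ D U * E h = E U * D h := by
  obtain ⟨d, hd⟩ := H.exists_natDegree
  have hinj := (algebraMap K R).injective
  have hU : ∀ k, U ≠ algebraMap K R k := by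
    rintro k rfl
    exact one_ne_zero (H.indep 1 0 0 k (by simp)).1
  have hT : C (D U) + E.coeffwise v = 0 := by
    have := H.trace
    simpa using this
  have hJ : D U * E h = E U * D h := by
    have := H.jac
    rw [Derivation.coeffwise_C, Derivation.coeffwise_C, ← C_mul, ← C_mul] at this
    exact C_injective this
  have hN : C (D U) * C (D U) + C (E U) * D.coeffwise v + derivative v * C (E h) = 0 := by
    have := H.minors
    simp only [Derivation.coeffwise_C, C_comp, derivative_C, zero_comp, zero_mul,
      zero_add] at this
    linear_combination C (D U) * hT - this
  have hTc : ∀ j, E (v.coeff (j + 1)) = 0 := fun j => by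
    have := congrArg (fun p => coeff p (j + 1)) hT
    simpa [coeff_C] using this
  have hNc : ∀ j, E U * D (v.coeff (j + 1)) + v.coeff (j + 2) * (j + 2) * E h = 0 := fun j => by
    have := congrArg (fun p => coeff p (j + 1)) hN
    rw [← C_mul] at this
    simp only [coeff_add, coeff_C, if_neg (Nat.succ_ne_zero j), coeff_C_mul, coeff_mul_C,
      Derivation.coeff_coeffwise, coeff_derivative, coeff_zero] at this
    push_cast at this
    linear_combination this
  have hEU : E U ≠ 0 := by
    intro h0
    rw [h0, C_0, zero_mul, add_zero] at hN
    rw [h0, zero_mul] at hJ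
    rcases mul_eq_zero.1 hJ with h1 | h1
    · obtain ⟨k, hk⟩ := P.const U h1 h0
      exact hU k hk
    · rw [h1, C_0, mul_zero, add_zero] at hN
      obtain ⟨k, hk⟩ := P.const U (C_eq_zero.1 (mul_self_eq_zero.1 hN)) h0
      exact hU k hk
  have hlv : v.coeff (d + 1) ≠ 0 := by
    rw [← hd, coeff_natDegree]
    exact leadingCoeff_ne_zero.2 fun h0 => H.deriv_ne (by rw [h0, derivative_zero])
  obtain ⟨t, ht⟩ : ∃ t, v.coeff (d + 1) = algebraMap K R t := by
    refine P.const _ ?_ (hTc d)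
    have := hNc d
    rw [coeff_eq_zero_of_natDegree_lt (p := v) (n := d + 2) (by omega), zero_mul, zero_mul,
      add_zero] at this
    exact (mul_eq_zero.1 this).resolve_left hEU
  have ht0 : t ≠ 0 := by
    rintro rfl
    exact hlv (by rw [ht, map_zero])
  -- If d > 0, the coefficient below the top one gives U_y σ + κ h_y = 0 with σ and κ constant,
  -- hence a linear relation between U and h.
  have hd0 : d = 0 := by
    by_contra hne
    obtain ⟨j, rfl⟩ : ∃ j, d = j + 1 := ⟨d - 1, by omega⟩
    have h1 := hNc j
    rw [show j + 2 = j + 1 + 1 by ring, ht] at h1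
    set σ := D (v.coeff (j + 1)) with hσ
    have hj2 : (j : R) + 2 ≠ 0 := by exact_mod_cast Nat.succ_ne_zero (j + 1)
    set κ : K := t * (j + 2) with hκ
    have hκR : algebraMap K R κ = algebraMap K R t * (j + 2) := by
      rw [hκ, map_mul, map_add, map_natCast, map_ofNat]
    have hκ0 : algebraMap K R κ ≠ 0 := hκR ▸ mul_ne_zero (ht ▸ hlv) hj2
    have h2 : E U * σ + algebraMap K R κ * E h = 0 := by rw [hκR]; exact h1
    have h3 : D U * σ + algebraMap K R κ * D h = 0 := by
      refine mul_left_cancel₀ hEU ?_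
      linear_combination D U * h2 - algebraMap K R κ * hJ
    have hEσ : E σ = 0 := by rw [hσ, ← P.comm, hTc, map_zero]
    have hDσ : D σ = 0 := by
      have h4 := congrArg D h2
      have h5 := congrArg E h3
      simp only [map_add, Derivation.leibniz, Derivation.map_algebraMap, smul_eq_mul, mul_zero,
        add_zero, map_zero, hEσ, P.comm, zero_add] at h4 h5
      have h6 : E U * D σ = 0 := by linear_combination h4 - h5
      exact (mul_eq_zero.1 h6).resolve_left hEU
    obtain ⟨s, hs⟩ := P.const σ hDσ hEσ
    obtain ⟨e, he⟩ := P.const (algebraMap K R s * U + algebraMap K R κ * h)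
      (by simp only [map_add, Derivation.leibniz, Derivation.map_algebraMap, ← hs, hDσ,
            smul_eq_mul, mul_zero, add_zero]; linear_combination h3)
      (by simp only [map_add, Derivation.leibniz, Derivation.map_algebraMap, ← hs, hEσ,
            smul_eq_mul, mul_zero, add_zero]; linear_combination h2)
    have := H.indep s 0 κ e (by rw [← he, C_comp, C_add]; simp)
    exact hκ0 (by rw [this.2.2, map_zero])
  subst hd0
  rw [zero_add] at ht
  have hv : v = C (v.coeff 0) + C (algebraMap K R t) * X := by
    conv_lhs => rw [eq_X_add_C_of_natDegree_le_one hd.le, ht]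
    ring
  refine ⟨hEU, v.coeff 0, t, ht0, hv, ?_, ?_, hJ⟩
  · have := congrArg (fun p => coeff p 0) hT
    simpa using this
  · have := congrArg (fun p => coeff p 0) hN
    rw [← C_mul] at this
    simp only [coeff_add, coeff_C_zero, coeff_C_mul, coeff_mul_C, Derivation.coeff_coeffwise,
      coeff_derivative, coeff_zero, zero_add, ht] at this
    push_cast at this
    linear_combination this

end NilpotentTriple

/-! ### Removing the term wz by a shear. -/

namespace NilpotentTriple

variable {K R : Type*} [Field K] [CommRing R] [Algebra K R] {D E : Derivation K R R}

theorem linear_indep {U h : R} {v : R[X]} (H : NilpotentTriple D E (C U) v h) {a c e : K}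
    (hac : algebraMap K R a * U + algebraMap K R c * h = algebraMap K R e) : a = 0 ∧ c = 0 := by
  have := H.indep a 0 c e (by rw [← hac, C_comp, C_add, C_mul (a := algebraMap K R a), map_zero, C_0]; ring)
  exact ⟨this.1, this.2.2⟩

/-- A shear `s` removes the linear dependence of `u` on its last variable. -/
theorem map_shear {w : K} {U h : R} {v : R[X]}
    (H : NilpotentTriple D E (C (algebraMap K R w) * X + C U) v h) (s : R →ₐ[K] R)
    (hs : Function.Injective s) (hD : ∀ a, D (s a) = s (D a))
    (hE : ∀ a, E (s a) = s (E a + algebraMap K R w * D a)) :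
    NilpotentTriple D E (C (s U)) (v.map (s : R →+* R)) (s h) := by
  have hsC : ∀ a : R, (C (s a) : R[X]) = (C a).map (s : R →+* R) := fun a => by
    rw [map_C]; rfl
  have hsw : ∀ a : K, (C (algebraMap K R a) : R[X]) =
      (C (algebraMap K R a)).map (s : R →+* R) := fun a => by
    rw [map_C, RingHom.coe_coe, AlgHom.commutes]
  have hDm : ∀ p : R[X], D.coeffwise (p.map (s : R →+* R)) =
      (D.coeffwise p).map (s : R →+* R) := fun p => by
    ext1 n
    simp only [Derivation.coeff_coeffwise, coeff_map, RingHom.coe_coe, hD]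
  have hEm : ∀ p : R[X], E.coeffwise (p.map (s : R →+* R)) =
      (E.coeffwise p + C (algebraMap K R w) * D.coeffwise p).map (s : R →+* R) := fun p => by
    ext1 n
    simp only [Derivation.coeff_coeffwise, coeff_map, coeff_add, coeff_C_mul, RingHom.coe_coe, hE]
  have hw : ∀ F : Derivation K R R,
      F.coeffwise (C (algebraMap K R w) * X + C U) = C (F U) := fun F => by
    rw [map_add, Derivation.leibniz, F.coeffwise_C, F.coeffwise_C, F.coeffwise_X,
      F.map_algebraMap]
    simp
  have hu' : derivative (C (algebraMap K R w) * X + C U) = C (algebraMap K R w) := by simp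
  have hT := H.trace
  have hN := H.minors
  have hJ := H.jac
  rw [hw, hu', C_comp, C_comp] at hT
  rw [hw, hw, hu', C_comp, C_comp, C_comp] at hN
  rw [hw, hw] at hJ
  have hinj := Polynomial.map_injective (s : R →+* R) hs
  refine ⟨?_, ?_, ?_, ?_, ?_⟩
  · rw [Derivation.coeffwise_C, C_comp, derivative_C, zero_comp, zero_mul, add_zero, hD, hsC,
      hEm, ← Polynomial.map_add, ← Polynomial.map_zero (s : R →+* R)]
    congr 1
    linear_combination hT
  · rw [Derivation.coeffwise_C, Derivation.coeffwise_C, C_comp, C_comp, derivative_C, zero_comp,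
      zero_mul, zero_add, hD, hE, hE, hsC, hsC, hsC, hEm, hDm, derivative_map,
      ← Polynomial.map_mul, ← Polynomial.map_mul, ← Polynomial.map_mul, ← Polynomial.map_sub,
      ← Polynomial.map_sub, ← Polynomial.map_zero (s : R →+* R)]
    congr 1
    simp only [C_add, C_mul]
    linear_combination hN
  · rw [Derivation.coeffwise_C, Derivation.coeffwise_C, hD, hD, hE, hE, hsC, hsC, hsC, hsC,
      ← Polynomial.map_mul, ← Polynomial.map_mul]
    congr 1
    simp only [C_add, C_mul]
    linear_combination hJ
  · rw [derivative_map]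
    exact fun h0 => H.deriv_ne (hinj (by rw [h0, Polynomial.map_zero]))
  · intro a b c e he
    have hsc : (C (algebraMap K R c * s h) : R[X]) =
        (C (algebraMap K R c * h)).map (s : R →+* R) := by
      rw [← hsC, map_mul s, AlgHom.commutes]
    rw [C_comp, hsc, hsC, hsw, hsw b, hsw e, ← Polynomial.map_mul, ← Polynomial.map_mul,
      ← Polynomial.map_add, ← Polynomial.map_add] at he
    have h1 := hinj he
    -- Since u(v) = wv + U, a relation with a·U is one with a·u(v) and the coefficient of v shifted
    -- by -aw.
    have h2 := H.indep a (b - a * w) c e (by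
      rw [← h1, add_comp, mul_comp, C_comp, C_comp, X_comp, map_sub, map_mul, C_sub, C_mul]
      ring)
    obtain ⟨rfl, hb, rfl⟩ := h2
    simpa using hb

end NilpotentTriple

/-! ### Explicit integration of the plane system. -/

namespace Plane

variable {K : Type*} [Field K]

theorem planePair [CharZero K] [IsAlgClosed K] : PlanePair (dx K) (dy K) where
  comm := dx_dy_comm
  const _ := exists_const
  factor _ _ := dx_eq_zero_of_mul
  sq _ := dy_eq_zero_of_sq_dvd
  rel _ _ := exists_linear_relation

/-- The chain rule for the substitution of `x` and `y` in a polynomial of `K[x][y]`. -/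
theorem derivation_aevalAeval {B : Type*} [CommRing B] [Algebra K B] (δ : Derivation K B B)
    (x y : B) (p : K[X][X]) :
    δ (aevalAeval x y p) =
      aevalAeval x y (dx K p) * δ x + aevalAeval x y (dy K p) * δ y := by
  induction p using Polynomial.induction_on' with
  | add p q hp hq => simp only [map_add, hp, hq]; ring
  | monomial n a =>
    have hC : ∀ b : K[X], aevalAeval x y (C b) = aeval x b := fun b => by simp
    have hX : aevalAeval (R := K) x y X = y := by simp
    rw [← C_mul_X_pow_eq_monomial]
    simp only [map_mul, map_pow, Derivation.leibniz, Derivation.leibniz_pow, dx_C, dy_C, dx_X,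
      dy_X, hC, hX, smul_eq_mul, nsmul_eq_mul, map_add, map_zero, map_natCast, map_one]
    have : δ (aeval x a) = aeval x (derivative a) * δ x := by
      rw [Derivation.map_aeval, smul_eq_mul]
    rw [this]
    ring

theorem eq_map_C_of_dx_eq_zero [CharZero K] {S : K[X][X]} (hS : dx K S = 0) :
    S = (S.map (evalRingHom 0)).map C := by
  ext1 i
  have h1 : derivative (S.coeff i) = 0 := by rw [← coeff_dx, hS, coeff_zero]
  rw [coeff_map, coeff_map, eq_C_of_derivative_eq_zero h1]
  simp

theorem aeval_C_X (a : K[X]) : aeval (C X : K[X][X]) a = C a := by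
  rw [show (C X : K[X][X]) = CAlgHom (R := K) X from rfl, aeval_algHom_apply, aeval_X_left]
  rfl

/-- The solutions of `U_x = b'(x) U_y` are the functions of `y + b(x)`. -/
theorem exists_eq_aeval [CharZero K] {U : K[X][X]} {b : K[X]}
    (h : dx K U = C (derivative b) * dy K U) : ∃ r : K[X], U = aeval (X + C b) r := by
  have hC : ∀ (q : K[X][X]) (a : K[X]), aevalAeval (R := K) (C X) q (C a) = C a := by
    intro q a
    rw [aevalAeval_C, aeval_C_X]
  -- The substitution y ↦ y - b(x) straightens the vector field ∂/∂x - b' ∂/∂y to ∂/∂x, so the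
  -- transformed polynomial depends on y only.
  set S := aevalAeval (R := K) (C X : K[X][X]) (X - C b) U with hS
  have hdS : dx K S = 0 := by
    rw [hS, derivation_aevalAeval, h, map_mul, hC, map_sub, dx_X, dx_C, dx_C, derivative_X]
    simp only [map_one, mul_one]
    ring
  have hSr := eq_map_C_of_dx_eq_zero hdS
  set r := S.map (evalRingHom (0 : K))
  have hcomp : (aevalAeval (R := K) (C X : K[X][X]) (X + C b)).comp
      (aevalAeval (R := K) (C X : K[X][X]) (X - C b)) = AlgHom.id K _ := by
    refine algHom_ext' (algHom_ext ?_) ?_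
    · change aevalAeval (R := K) (C X : K[X][X]) (X + C b) (aevalAeval (R := K) (C X : K[X][X]) (X - C b) (C X)) = C X
      rw [hC, hC]
    · change aevalAeval (R := K) (C X : K[X][X]) (X + C b) (aevalAeval (R := K) (C X : K[X][X]) (X - C b) X) = X
      rw [aevalAeval_Y, map_sub, hC, aevalAeval_Y, add_sub_cancel_right]
  have hr : ∀ r : K[X], aevalAeval (R := K) (C X : K[X][X]) (X + C b) (r.map C) = aeval (X + C b) r := by
    intro r
    induction r using Polynomial.induction_on' with
    | add p q hp hq => rw [Polynomial.map_add, map_add, hp, hq, map_add]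
    | monomial n a =>
      rw [map_monomial, ← C_mul_X_pow_eq_monomial, ← C_mul_X_pow_eq_monomial, map_mul, map_mul,
        map_pow, map_pow, aevalAeval_Y, hC, aeval_C, aeval_X]
      rfl
  refine ⟨r, ?_⟩
  rw [← hr, ← hSr]
  exact (DFunLike.congr_fun hcomp U).symm

/-- The substitution `x ↦ x + w y` of `K[x][y]`. -/
noncomputable def shear (w : K) : K[X][X] →ₐ[K] K[X][X] :=
  aevalAeval (C X + C (C w) * X) X

theorem dx_shear (w : K) (p : K[X][X]) : dx K (shear w p) = shear w (dx K p) := by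
  rw [shear, derivation_aevalAeval, dx_X, map_add, dx_C, Derivation.leibniz, dx_C, dx_X]
  simp

theorem dy_shear (w : K) (p : K[X][X]) :
    dy K (shear w p) = shear w (dy K p + C (C w) * dx K p) := by
  rw [shear, derivation_aevalAeval, dy_X, map_add, dy_C, Derivation.leibniz, dy_C, dy_X]
  simp
  ring

theorem shear_injective (w : K) : Function.Injective (shear w) := by
  have : (shear (-w)).comp (shear w) = AlgHom.id K _ := by
    refine algHom_ext' (algHom_ext ?_) ?_
    · change shear (-w) (shear w (C X)) = C X
      simp [shear]
      ring
    · change shear (-w) (shear w X) = X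
      simp [shear]
  exact Function.LeftInverse.injective (g := shear (-w)) (DFunLike.congr_fun this)

/-- The shape of a nilpotent triple all of whose components vanish at the origin and whose first
component does not depend on `z`. -/
theorem exists_shape [CharZero K] [IsAlgClosed K] {U h : K[X][X]} {v : K[X][X][X]}
    (H : NilpotentTriple (dx K) (dy K) (C U) v h) (hU0 : (U.eval 0).eval 0 = 0)
    (hv0 : ((v.eval 0).eval 0).eval 0 = 0) (hh0 : (h.eval 0).eval 0 = 0) :
    ∃ (t γ l ε : K) (b r : K[X]), t ≠ 0 ∧ γ ≠ 0 ∧ r.eval 0 = 0 ∧ 1 ≤ r.natDegree ∧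
      b = C (γ / 2) * X ^ 2 + C l * X ∧ U = aeval (X + C b) r ∧
      v = C (C (C ε * X) - C (derivative b) * U) + C (C (C t)) * X ∧
      h = C (C (γ / (2 * t))) * U ^ 2 - C (C (ε / t)) * U := by
  obtain ⟨hEU, V, t, ht, hv, hT, hN, hJ⟩ := H.exists_eq_add_C_mul_X planePair
  set T := algebraMap K K[X][X] t with hTdef
  have hF : ∀ F : Derivation K K[X][X] K[X][X], F (T * h) = T * F h := fun F => by
    rw [Derivation.leibniz, F.map_algebraMap]; simp
  have hN' : dx K U ^ 2 + dy K U * dx K V + dy K (T * h) = 0 := by rw [hF]; exact hN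
  have hJ' : dx K U * dy K (T * h) = dy K U * dx K (T * h) := by
    rw [hF, hF]; linear_combination T * hJ
  obtain ⟨c, hc⟩ := exists_dx_eq_mul_dy hT hN' hJ' hEU
  obtain ⟨e, γ, ε, k, hγ, hε, hV, hh⟩ := exists_eq_of_dx_eq_mul_dy hT hN' hJ' hEU hc
  have h2 : (2 : K) ≠ 0 := two_ne_zero
  -- For γ = 0 the formula for h is a linear relation between U and h.
  have hγ0 : γ ≠ 0 := by
    rintro rfl
    have h3 := H.linear_indep (a := 2 * ε) (c := 2 * t) (e := k) (by
      rw [map_mul, map_mul, map_ofNat, ← hTdef]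
      rw [map_zero] at hh
      linear_combination hh)
    exact mul_ne_zero h2 ht h3.2
  obtain ⟨l, hcl⟩ : ∃ l, c = C γ * X + C l := by
    refine ⟨c.coeff 0, ?_⟩
    have h1 : derivative (c - C γ * X) = 0 := by simp [hγ]
    have h3 := eq_C_of_derivative_eq_zero h1
    have h4 : (c - C γ * X).coeff 0 = c.coeff 0 := by simp
    rw [h4] at h3
    linear_combination h3
  obtain ⟨e₀, he⟩ : ∃ e₀, e = C ε * X + C e₀ := by
    refine ⟨e.coeff 0, ?_⟩
    have h1 : derivative (e - C ε * X) = 0 := by simp [hε]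
    have h3 := eq_C_of_derivative_eq_zero h1
    have h4 : (e - C ε * X).coeff 0 = e.coeff 0 := by simp
    rw [h4] at h3
    linear_combination h3
  have he0 : e₀ = 0 := by
    rw [hv, hV, he] at hv0
    simpa [hU0] using hv0
  have hk0 : k = 0 := by
    have h1 := congrArg (fun p : K[X][X] => (p.eval 0).eval 0) hh
    simp only [hTdef, show ∀ a, algebraMap K K[X][X] a = C (C a) from fun _ => rfl, eval_mul,
      eval_add, eval_sub, eval_pow, eval_C, eval_ofNat, hU0, hh0] at h1
    simpa using h1.symm
  set b : K[X] := C (γ / 2) * X ^ 2 + C l * X with hb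
  have hb' : derivative b = c := by
    rw [hcl, hb]
    simp only [derivative_add, derivative_mul, derivative_C, derivative_X_pow, derivative_X,
      zero_mul, zero_add, mul_one, Nat.cast_ofNat, Nat.add_one_sub_one, pow_one]
    rw [← mul_assoc, ← C_mul, div_mul_cancel₀ _ h2]
  obtain ⟨r, hr⟩ := exists_eq_aeval (b := b) (hb'.symm ▸ hc)
  refine ⟨t, γ, l, ε, b, r, ht, hγ0, ?_, ?_, rfl, hr, ?_, ?_⟩
  · have hev : ∀ q : K[X], ((aeval (X + C b : K[X][X]) q).eval 0).eval 0 = q.eval 0 := by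
      intro q
      induction q using Polynomial.induction_on' with
      | add p q hp hq => rw [map_add, eval_add, eval_add, hp, hq, eval_add]
      | monomial n a =>
        rw [← C_mul_X_pow_eq_monomial, map_mul, map_pow, aeval_X, aeval_C,
          show algebraMap K K[X][X] a = C (C a) from rfl]
        simp [hb]
    rw [← hev, ← hr]
    exact hU0
  · by_contra hlt
    refine hEU ?_
    rw [hr, eq_C_of_natDegree_eq_zero (p := r) (by omega), aeval_C]
    exact (dy K).map_algebraMap _
  · rw [hb', hv, hV, he, he0, C_0, add_zero]; rfl
  · have h3 : (2 * T) * h = C (C γ) * U ^ 2 - 2 * C (C ε) * U := by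
      rw [hk0, map_zero, add_zero, ← mul_assoc] at hh
      exact hh
    have h4 : (2 * T) = C (C (2 * t)) := by
      rw [hTdef, C_mul, C_mul]; rfl
    have h5 : (2 * T) ≠ 0 := by
      rw [h4]; exact C_ne_zero.2 (C_ne_zero.2 (mul_ne_zero h2 ht))
    refine mul_left_cancel₀ h5 ?_
    rw [h3, h4, mul_sub, ← mul_assoc, ← mul_assoc, ← C_mul, ← C_mul, ← C_mul, ← C_mul,
      mul_div_cancel₀ _ (mul_ne_zero h2 ht), mul_assoc 2 t, mul_div_cancel₀ _ ht, C_mul, C_mul]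
    rfl

end Plane

/-! ### From a nilpotent matrix to the equations of a triple. -/

namespace Matrix

/-- The traces of M and M² are nilpotent in a domain, hence zero, and twice the sum of the principal
2-minors is tr(M)² - tr(M²). -/
theorem trace_det_of_isNilpotent_three {R : Type*} [CommRing R] [IsDomain R] [CharZero R]
    {M : Matrix (Fin 3) (Fin 3) R} (hM : IsNilpotent M) :
    M 0 0 + M 1 1 + M 2 2 = 0 ∧
      (M 0 0 * M 1 1 - M 0 1 * M 1 0) + (M 0 0 * M 2 2 - M 0 2 * M 2 0)
        + (M 1 1 * M 2 2 - M 1 2 * M 2 1) = 0 ∧ M.det = 0 := by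
  have h1 : M.trace = 0 := (isNilpotent_trace_of_isNilpotent hM).eq_zero
  have h2 : (M * M).trace = 0 := by
    rw [← sq]
    exact (isNilpotent_trace_of_isNilpotent (hM.pow_of_pos two_ne_zero)).eq_zero
  have h3 : M.det = 0 := by
    obtain ⟨n, hn⟩ := hM
    have h4 : M.det ^ n = 0 := by
      rw [← det_pow, hn]
      exact det_zero
    exact eq_zero_of_pow_eq_zero h4
  rw [trace_fin_three] at h1 h2
  simp only [mul_apply, Fin.sum_univ_three] at h2
  refine ⟨h1, ?_, h3⟩
  have h4 : (2 : R) * ((M 0 0 * M 1 1 - M 0 1 * M 1 0) + (M 0 0 * M 2 2 - M 0 2 * M 2 0)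
        + (M 1 1 * M 2 2 - M 1 2 * M 2 1)) = 0 := by
    linear_combination (M 0 0 + M 1 1 + M 2 2) * h1 - h2
  exact (mul_eq_zero.1 h4).resolve_left two_ne_zero

end Matrix

namespace NilpotentTriple

variable {K R : Type*} [Field K] [CommRing R] [Algebra K R] [IsDomain R] [CharZero R]
  {D E : Derivation K R R}

/-- The equations of a nilpotent triple, from the coefficients of the characteristic polynomial of
the Jacobian matrix. -/
theorem of_charpoly (P : PlanePair D E) {u v : R[X]} {h : R}
    (h1 : D.coeffwise (u.comp v) + E.coeffwise v + derivative (C h) = 0)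
    (h2 : (D.coeffwise (u.comp v) * E.coeffwise v - E.coeffwise (u.comp v) * D.coeffwise v)
      + (D.coeffwise (u.comp v) * derivative (C h) - derivative (u.comp v) * D.coeffwise (C h))
      + (E.coeffwise v * derivative (C h) - derivative v * E.coeffwise (C h)) = 0)
    (h3 : D.coeffwise (u.comp v) * E.coeffwise v * derivative (C h)
      - D.coeffwise (u.comp v) * derivative v * E.coeffwise (C h)
      - E.coeffwise (u.comp v) * D.coeffwise v * derivative (C h)
      + E.coeffwise (u.comp v) * derivative v * D.coeffwise (C h)
      + derivative (u.comp v) * D.coeffwise v * E.coeffwise (C h)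
      - derivative (u.comp v) * E.coeffwise v * D.coeffwise (C h) = 0)
    (hind : ∀ a b c e : K, C (algebraMap K R a) * u.comp v + C (algebraMap K R b) * v
      + C (algebraMap K R c * h) = C (algebraMap K R e) → a = 0 ∧ b = 0 ∧ c = 0) :
    NilpotentTriple D E u v h := by
  rw [derivative_C] at h1 h2 h3
  rw [D.coeffwise_C, E.coeffwise_C] at h2 h3
  -- If v were free of z, the first two equations would be those of a nilpotent plane map,
  -- contradicting independence.
  have hv : derivative v ≠ 0 := by
    intro h0
    obtain ⟨V, hV⟩ : ∃ V, v = C V := ⟨_, eq_C_of_derivative_eq_zero h0⟩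
    obtain ⟨W, hW⟩ : ∃ W, u.comp v = C W := by
      rw [hV, comp_C]; exact ⟨_, rfl⟩
    rw [hW, hV, D.coeffwise_C, E.coeffwise_C, add_zero, ← C_add, C_eq_zero] at h1
    rw [hW, hV] at h2
    simp only [Derivation.coeffwise_C, derivative_C, zero_mul, mul_zero, sub_zero, add_zero,
      ← C_mul, ← C_sub, C_eq_zero] at h2
    obtain ⟨a, b, e, hab, he⟩ := P.rel W V h1 (sub_eq_zero.1 h2)
    have := hind a b 0 e (by
      rw [hW, hV, ← C_mul, ← C_mul, ← C_add, ← C_add, he, map_zero, zero_mul, add_zero])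
    simp [this.1, this.2.1] at hab
  rw [D.coeffwise_comp] at h1
  rw [D.coeffwise_comp, E.coeffwise_comp, derivative_comp] at h2 h3
  refine ⟨?_, ?_, ?_, hv, hind⟩
  · linear_combination h1
  · linear_combination h2
  · have h4 : derivative v * (D.coeffwise u * C (E h) - E.coeffwise u * C (D h)).comp v = 0 := by
      simp only [sub_comp, mul_comp, C_comp]
      linear_combination -h3
    rcases comp_eq_zero_iff.1 ((mul_eq_zero.1 h4).resolve_left hv) with h5 | h5
    · exact sub_eq_zero.1 h5
    · exact absurd (by rw [h5.2, derivative_C]) hv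

end NilpotentTriple

/-! ### Translation between K[x,y,z] and R[z]. -/

namespace PolyMap

section Substitution

variable {K R : Type*} [Field K] [CommRing R] [Algebra K R]

/-- The homomorphism `K[x, y, z] → R[z]` given by the images of `x` and `y` in `R`. -/
noncomputable def toPoly (x y : R) : MvPolynomial (Fin 3) K →ₐ[K] R[X] :=
  MvPolynomial.aeval (![C x, C y, X] : Fin 3 → R[X])

variable (x y : R)

@[simp]
theorem toPoly_C (a : K) : toPoly x y (MvPolynomial.C a) = C (algebraMap K R a) := by
  rw [toPoly, MvPolynomial.aeval_C]
  rfl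

@[simp]
theorem toPoly_X_zero : toPoly (K := K) x y (MvPolynomial.X 0) = C x := by
  simp [toPoly]

@[simp]
theorem toPoly_X_one : toPoly (K := K) x y (MvPolynomial.X 1) = C y := by
  simp [toPoly]

@[simp]
theorem toPoly_X_two : toPoly (K := K) x y (MvPolynomial.X 2) = X := by
  simp [toPoly]

theorem toPoly_injective (f : R →+* MvPolynomial (Fin 3) K)
    (hf : ∀ a, f (algebraMap K R a) = MvPolynomial.C a) (hx : f x = MvPolynomial.X 0)
    (hy : f y = MvPolynomial.X 1) : Function.Injective (toPoly (K := K) x y) := by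
  have key : ∀ p, eval₂RingHom f (MvPolynomial.X 2) (toPoly x y p) = p := by
    intro p
    induction p using MvPolynomial.induction_on with
    | C a => rw [toPoly_C, coe_eval₂RingHom, eval₂_C, hf]
    | add p q hp hq => rw [map_add, map_add, hp, hq]
    | mul_X p i hp =>
      rw [map_mul, map_mul, hp]
      congr 1
      fin_cases i <;> simp [hx, hy]
  exact Function.LeftInverse.injective key

/-- Both sides are derivations along `toPoly`, so agreement on the variables suffices. -/
theorem toPoly_pderiv {D : Derivation K R[X] R[X]} {j : Fin 3}
    (h0 : D (C x) = toPoly (K := K) x y (MvPolynomial.pderiv j (MvPolynomial.X 0)))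
    (h1 : D (C y) = toPoly (K := K) x y (MvPolynomial.pderiv j (MvPolynomial.X 1)))
    (h2 : D X = toPoly (K := K) x y (MvPolynomial.pderiv j (MvPolynomial.X 2)))
    (p : MvPolynomial (Fin 3) K) :
    toPoly x y (MvPolynomial.pderiv j p) = D (toPoly x y p) := by
  induction p using MvPolynomial.induction_on with
  | C a =>
    rw [MvPolynomial.pderiv_C, map_zero, toPoly_C]
    exact (D.map_algebraMap a).symm
  | add p q hp hq => simp only [map_add, hp, hq]
  | mul_X p i hp =>
    rw [Derivation.leibniz, map_add, smul_eq_mul, smul_eq_mul, map_mul, map_mul, hp, map_mul,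
      Derivation.leibniz, smul_eq_mul, smul_eq_mul]
    congr 2
    fin_cases i
    · exact h0.symm.trans (by rw [← toPoly_X_zero (K := K) x y]; rfl)
    · exact h1.symm.trans (by rw [← toPoly_X_one (K := K) x y]; rfl)
    · exact h2.symm.trans (by rw [← toPoly_X_two (K := K) x y]; rfl)

theorem toPoly_bind (u v : MvPolynomial (Fin 3) K) :
    toPoly x y (MvPolynomial.bind₁ ![MvPolynomial.X 0, MvPolynomial.X 1, v] u) =
      (toPoly x y u).comp (toPoly x y v) := by
  induction u using MvPolynomial.induction_on with
  | C a => rw [MvPolynomial.bind₁_C_right, toPoly_C, C_comp]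
  | add p q hp hq => simp only [map_add, hp, hq, add_comp]
  | mul_X p i hp =>
    rw [map_mul, map_mul, hp, map_mul, mul_comp, MvPolynomial.bind₁_X_right]
    congr 1
    fin_cases i <;> simp

theorem toPoly_bind_two (h : MvPolynomial (Fin 2) K) :
    toPoly x y (MvPolynomial.bind₁ ![MvPolynomial.X 0, MvPolynomial.X 1] h) =
      C (MvPolynomial.aeval ![x, y] h) := by
  induction h using MvPolynomial.induction_on with
  | C a => rw [MvPolynomial.bind₁_C_right, toPoly_C, MvPolynomial.aeval_C]
  | add p q hp hq => simp only [map_add, hp, hq]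
  | mul_X p i hp =>
    rw [map_mul, map_mul, hp, map_mul, C_mul, MvPolynomial.bind₁_X_right]
    congr 1
    fin_cases i <;> simp

theorem map_eval_toPoly (f : R →+* K) (hf : ∀ a, f (algebraMap K R a) = a) (hx : f x = 0)
    (hy : f y = 0) (p : MvPolynomial (Fin 3) K) :
    f ((toPoly x y p).eval 0) = MvPolynomial.eval 0 p := by
  induction p using MvPolynomial.induction_on with
  | C a => rw [toPoly_C, eval_C, hf, MvPolynomial.eval_C]
  | add p q hp hq => simp only [map_add, eval_add, hp, hq]
  | mul_X p i hp =>
    rw [map_mul, eval_mul, map_mul, hp, map_mul]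
    congr 1
    fin_cases i <;> simp [hx, hy]

/-- The equations satisfied by a map `(u(x, y, v), v, h)` with nilpotent Jacobian matrix and
linearly independent components. -/
theorem nilpotentTriple [IsDomain R] [CharZero R] [CharZero K] {D E : Derivation K R R}
    (P : PlanePair D E) {x y : R} (hDx : D x = 1) (hDy : D y = 0) (hEx : E x = 0) (hEy : E y = 1)
    (hinj : Function.Injective (toPoly (K := K) x y)) (u v : MvPolynomial (Fin 3) K)
    (h : MvPolynomial (Fin 2) K)
    (hzero : ∀ i, MvPolynomial.eval 0 (composedMap u v h i) = 0)
    (hindep : LinearIndependent K (composedMap u v h))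
    (hnil : IsNilpotent (jacobian (composedMap u v h))) :
    NilpotentTriple D E (toPoly x y u) (toPoly x y v) (MvPolynomial.aeval ![x, y] h) := by
  obtain ⟨h1, h2, h3⟩ := Matrix.trace_det_of_isNilpotent_three hnil
  have hH0 : toPoly x y (composedMap u v h 0) = (toPoly x y u).comp (toPoly x y v) :=
    toPoly_bind x y u v
  have hH1 : toPoly x y (composedMap u v h 1) = toPoly x y v := rfl
  have hH2 : toPoly x y (composedMap u v h 2) = C (MvPolynomial.aeval ![x, y] h) :=
    toPoly_bind_two x y h
  have hp0 := toPoly_pderiv (K := K) x y (D := D.coeffwise) (j := 0)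
    (by simp [hDx]) (by simp [hDy, MvPolynomial.pderiv_X]) (by simp [MvPolynomial.pderiv_X])
  have hp1 := toPoly_pderiv (K := K) x y (D := E.coeffwise) (j := 1)
    (by simp [hEx, MvPolynomial.pderiv_X]) (by simp [hEy]) (by simp [MvPolynomial.pderiv_X])
  have hp2 : ∀ p : MvPolynomial (Fin 3) K,
      toPoly x y (MvPolynomial.pderiv 2 p) = derivative (toPoly x y p) :=
    toPoly_pderiv (K := K) x y (D := (derivative' : Derivation R R[X] R[X]).restrictScalars K)
      (j := 2) (by simp [MvPolynomial.pderiv_X]) (by simp [MvPolynomial.pderiv_X]) (by simp)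
  have h1 := congrArg (toPoly x y) h1
  have h2 := congrArg (toPoly x y) h2
  have h3 := congrArg (toPoly x y) h3
  rw [Matrix.det_fin_three] at h3
  simp only [jacobian, Matrix.of_apply, map_add, map_sub, map_mul, map_zero, hp0, hp1, hp2,
    hH0, hH1, hH2] at h1 h2 h3
  refine NilpotentTriple.of_charpoly P h1 h2 h3 ?_
  intro a b c e he
  rw [C_mul, ← hH0, ← hH1, ← hH2, ← toPoly_C x y, ← toPoly_C x y, ← toPoly_C x y,
    ← toPoly_C x y, ← map_mul, ← map_mul, ← map_mul, ← map_add, ← map_add] at he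
  have he' := hinj he
  -- All components vanish at the origin, so independence over K is independence modulo constants.
  have he0 : e = 0 := by
    have := congrArg (MvPolynomial.eval 0) he'
    simpa only [map_add, map_mul, hzero, MvPolynomial.eval_C, mul_zero, add_zero] using this.symm
  rw [he0, map_zero] at he'
  have := Fintype.linearIndependent_iff.1 hindep ![a, b, c] (by
    rw [Fin.sum_univ_three]
    simp only [MvPolynomial.smul_eq_C_mul]
    exact he')
  exact ⟨this 0, this 1, this 2⟩

end Substitution

end PolyMap

/-! ### Conjugation to the normal form. -/

namespace PolyMap

section Conjugation

variable {K R : Type*} [Field K] [CommRing R] [Algebra K R]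

/-- The linear change of coordinates `(x, y, z) ↦ (y + w x, x, z)`. -/
def swapShear (w : K) : GL (Fin 3) K where
  val := !![w, 1, 0; 1, 0, 0; 0, 0, 1]
  inv := !![0, 1, 0; 1, -w, 0; 0, 0, 1]
  val_inv := by
    ext i j
    fin_cases i <;> fin_cases j <;> simp [Matrix.mul_apply, Fin.sum_univ_three]
  inv_val := by
    ext i j
    fin_cases i <;> fin_cases j <;> simp [Matrix.mul_apply, Fin.sum_univ_three]

/-- Reading the target through `toPoly y x` absorbs the exchange of the first two coordinates; only
the shear of R remains. -/
theorem toPoly_bind_swapShear {x y : R} {w : K} (s : R →ₐ[K] R)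
    (hx : s x = x + algebraMap K R w * y) (hy : s y = y) (p : MvPolynomial (Fin 3) K) :
    toPoly y x (MvPolynomial.bind₁
      (fun k => ∑ l, MvPolynomial.C ((swapShear w).val k l) * MvPolynomial.X l) p) =
      (toPoly x y p).map (s : R →+* R) := by
  induction p using MvPolynomial.induction_on with
  | C a =>
    rw [MvPolynomial.bind₁_C_right, toPoly_C, toPoly_C, map_C, RingHom.coe_coe, AlgHom.commutes]
  | add p q hp hq => simp only [map_add, hp, hq, Polynomial.map_add]
  | mul_X p i hp =>
    rw [map_mul, map_mul, hp, map_mul, Polynomial.map_mul, MvPolynomial.bind₁_X_right]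
    congr 1
    fin_cases i
    · simp [swapShear, Fin.sum_univ_three, hx, add_comm]
    · simp [swapShear, Fin.sum_univ_three, hy]
    · simp [swapShear, Fin.sum_univ_three]

/-- The exchange puts v first and u(v) - wv second, where the normal form expects g(ax + b(y)). -/
theorem toPoly_conj_swapShear {x y : R} {w : K} (s : R →ₐ[K] R)
    (hx : s x = x + algebraMap K R w * y) (hy : s y = y) (H : PolyMap3 K) :
    toPoly y x (conj (swapShear w) H 0) = (toPoly x y (H 1)).map (s : R →+* R) ∧
    toPoly y x (conj (swapShear w) H 1) = (toPoly x y (H 0)).map (s : R →+* R)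
      - C (algebraMap K R w) * (toPoly x y (H 1)).map (s : R →+* R) ∧
    toPoly y x (conj (swapShear w) H 2) = (toPoly x y (H 2)).map (s : R →+* R) := by
  have hsum : ∀ i, toPoly y x (conj (swapShear w) H i) =
      ∑ j, C (algebraMap K R (!![0, 1, 0; 1, -w, 0; 0, 0, 1] i j)) *
        (toPoly x y (H j)).map (s : R →+* R) := fun i => by
    rw [conj, map_sum]
    refine Finset.sum_congr rfl fun j _ => ?_
    rw [map_mul, toPoly_C, toPoly_bind_swapShear s hx hy]
    rfl
  refine ⟨?_, ?_, ?_⟩ <;> rw [hsum, Fin.sum_univ_three] <;> simp [sub_eq_add_neg]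

theorem toPoly_aeval (x y : R) (q : MvPolynomial (Fin 3) K) (g : K[X]) :
    toPoly x y (aeval q g) = aeval (toPoly x y q) g :=
  (aeval_algHom_apply (toPoly x y) q g).symm

theorem aeval_C_eq (a : R) (g : K[X]) : aeval (C a : R[X]) g = C (aeval a g) := by
  rw [show (C a : R[X]) = CAlgHom (R := K) a from rfl, aeval_algHom_apply]
  rfl

theorem toPoly_normalMap (x y : R) (u₁ c₀ l₂ : K) (b g : K[X]) :
    toPoly y x (normalMap u₁ c₀ 1 l₂ b g 0) =
      C (algebraMap K R u₁) * X - C (aeval x (derivative b) * aeval (y + aeval x b) g)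
        - C (algebraMap K R (u₁ * l₂) * x) ∧
    toPoly y x (normalMap u₁ c₀ 1 l₂ b g 1) = C (aeval (y + aeval x b) g) ∧
    toPoly y x (normalMap u₁ c₀ 1 l₂ b g 2) =
      C (algebraMap K R c₀ * aeval (y + aeval x b) g ^ 2
        + algebraMap K R l₂ * aeval (y + aeval x b) g) := by
  have hv : toPoly y x (aeval (MvPolynomial.C (1 : K) * MvPolynomial.X 0
      + aeval (MvPolynomial.X 1 : MvPolynomial (Fin 3) K) b) g) = C (aeval (y + aeval x b) g) := by
    rw [toPoly_aeval, map_add, toPoly_aeval, map_mul, toPoly_C, toPoly_X_zero, toPoly_X_one,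
      aeval_C_eq, map_one, C_1, one_mul, ← C_add, aeval_C_eq]
  refine ⟨?_, ?_, ?_⟩
  · simp only [normalMap, Matrix.cons_val_zero, map_sub, map_mul, hv, inv_one, toPoly_C,
      toPoly_X_two, toPoly_X_one]
    rw [toPoly_aeval, toPoly_X_one, aeval_C_eq, map_one, C_1, one_mul]
  · exact hv
  · simp only [normalMap, Matrix.cons_val, map_add, map_mul, map_pow, hv, toPoly_C]

end Conjugation

variable {K : Type*} [Field K]

theorem toPoly_injective_of_iterated :
    Function.Injective (toPoly (K := K) (C X : K[X][X]) X) ∧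
      Function.Injective (toPoly (K := K) (X : K[X][X]) (C X)) := by
  constructor
  · refine toPoly_injective _ _ (eval₂RingHom (eval₂RingHom MvPolynomial.C (MvPolynomial.X 0))
      (MvPolynomial.X 1)) (fun a => ?_) ?_ ?_
    · rw [show algebraMap K K[X][X] a = C (C a) from rfl]; simp
    · simp
    · simp
  · refine toPoly_injective _ _ (eval₂RingHom (eval₂RingHom MvPolynomial.C (MvPolynomial.X 1))
      (MvPolynomial.X 0)) (fun a => ?_) ?_ ?_
    · rw [show algebraMap K K[X][X] a = C (C a) from rfl]; simp
    · simp
    · simp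

/-- The classification without the hypothesis on degrees. -/
theorem exists_hasNormalForm_conj [IsAlgClosed K] [CharZero K] (u v : MvPolynomial (Fin 3) K)
    (h : MvPolynomial (Fin 2) K) (hzero : ∀ i, MvPolynomial.eval 0 (composedMap u v h i) = 0)
    (hindep : LinearIndependent K (composedMap u v h))
    (hnil : IsNilpotent (jacobian (composedMap u v h))) :
    ∃ T : GL (Fin 3) K, HasNormalForm (conj T (composedMap u v h)) := by
  have P := Plane.planePair (K := K)
  have H := nilpotentTriple P (x := C X) (y := X) (by simp) (by simp) (by simp) (by simp)
    toPoly_injective_of_iterated.1 u v h hzero hindep hnil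
  have hH0 := toPoly_bind (C X : K[X][X]) X u v
  have hH2 := toPoly_bind_two (C X : K[X][X]) X h
  have hu := H.natDegree_le_one P
  obtain ⟨w, hw⟩ := H.coeff_one_eq_const P hu
  have hu' := eq_X_add_C_of_natDegree_le_one hu
  rw [hw] at hu'
  set U := (toPoly (C X : K[X][X]) X u).coeff 0
  set g := MvPolynomial.aeval ![(C X : K[X][X]), X] h
  rw [hu'] at H hH0
  have hx : Plane.shear w (C X) = C X + algebraMap K K[X][X] w * X := by
    rw [Plane.shear, aevalAeval_X]; rfl
  have hy : Plane.shear w (X : K[X][X]) = X := by rw [Plane.shear, aevalAeval_Y]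
  have H' := H.map_shear (Plane.shear w) (Plane.shear_injective w) (Plane.dx_shear w)
    (Plane.dy_shear w)
  obtain ⟨hc0, hc1, hc2⟩ := toPoly_conj_swapShear (Plane.shear w) hx hy (composedMap u v h)
  set f : K[X][X] →+* K := (evalRingHom 0).comp (evalRingHom 0) with hf
  have hfC : ∀ a, f (algebraMap K K[X][X] a) = a := fun a => by
    rw [show algebraMap K K[X][X] a = C (C a) from rfl, hf]; simp
  have hfx : f (C X) = 0 := by simp [hf]
  have hfy : f X = 0 := by simp [hf]
  have hev := map_eval_toPoly (K := K) (C X : K[X][X]) X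
    (f.comp (Plane.shear w : K[X][X] →+* K[X][X]))
    (fun a => by rw [RingHom.comp_apply, RingHom.coe_coe, AlgHom.commutes, hfC])
    (by rw [RingHom.comp_apply, RingHom.coe_coe, hx, map_add, map_mul, hfx, hfy, mul_zero,
      add_zero])
    (by rw [RingHom.comp_apply, RingHom.coe_coe, hy, hfy])
  have hH0' : toPoly (C X : K[X][X]) X (composedMap u v h 0) =
      (C (algebraMap K K[X][X] w) * X + C U).comp (toPoly (C X) X v) := hH0
  have hH1' : toPoly (C X : K[X][X]) X (composedMap u v h 1) = toPoly (C X : K[X][X]) X v := rfl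
  have hH2' : toPoly (C X : K[X][X]) X (composedMap u v h 2) = C g := hH2
  rw [add_comp, mul_comp, C_comp, C_comp, X_comp] at hH0'
  have hev1 := hev (composedMap u v h 1)
  have hev0 := hev (composedMap u v h 0)
  have hev2 := hev (composedMap u v h 2)
  rw [hzero, hH1', RingHom.comp_apply] at hev1
  rw [hzero, hH0', eval_add, eval_mul, eval_C, eval_C, map_add, map_mul, RingHom.comp_apply,
    RingHom.comp_apply, RingHom.comp_apply, hev1, mul_zero, zero_add] at hev0
  rw [hzero, hH2', eval_C, RingHom.comp_apply] at hev2
  obtain ⟨t, γ, l, ε, b, r, ht, hγ, hr0, hr1, hb, hU, hv, hg⟩ := Plane.exists_shape H' hev0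
    (by rw [eval_zero_map]; exact hev1) hev2
  rw [hH1'] at hc0 hc1
  rw [hH0', Polynomial.map_add, Polynomial.map_mul, map_C, map_C, RingHom.coe_coe,
    AlgHom.commutes, add_sub_cancel_left] at hc1
  rw [hH2', map_C, RingHom.coe_coe] at hc2
  have h2 : (2 : K) ≠ 0 := two_ne_zero
  have hb' : C (t * (γ / (2 * t)) * 1) * X ^ 2 + C l * X + C 0 = b := by
    rw [hb, C_0, add_zero]
    congr 3
    field_simp
  -- Since U = r(y + b(x)), one may take a = 1; c₀ = γ/(2t) is the coefficient of U² in h, and u₁c₀a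
  -- = γ/2 is the quadratic coefficient of b.
  refine ⟨swapShear w, t, γ / (2 * t), 1, l, -ε / t, 0, r, ht,
    div_ne_zero hγ (mul_ne_zero h2 ht), one_ne_zero, hr0, hr1, ?_⟩
  rw [hb']
  obtain ⟨hn0, hn1, hn2⟩ :=
    toPoly_normalMap (C X : K[X][X]) X t (γ / (2 * t)) (-ε / t) b r
  rw [Plane.aeval_C_X, Plane.aeval_C_X, ← hU] at hn0
  rw [Plane.aeval_C_X, ← hU] at hn1 hn2
  funext i
  refine toPoly_injective_of_iterated.2 ?_
  fin_cases i
  · refine hc0.trans (Eq.trans ?_ hn0.symm)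
    have hε : algebraMap K K[X][X] (-ε) * C X = -(C (C ε * X)) := by
      rw [show algebraMap K K[X][X] (-ε) = C (C (-ε)) from rfl, ← C_mul, C_neg, neg_mul, C_neg]
    rw [hv, mul_div_cancel₀ _ ht, hε, C_sub, C_neg (a := C (C ε * X)), sub_neg_eq_add]
    rw [show algebraMap K K[X][X] t = C (C t) from rfl]
    abel
  · exact hc1.trans hn1.symm
  · refine hc2.trans (Eq.trans ?_ hn2.symm)
    congr 1
    rw [hg, show algebraMap K K[X][X] (-ε / t) = C (C (-ε / t)) from rfl, neg_div, C_neg, C_neg]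
    rw [show algebraMap K K[X][X] (γ / (2 * t)) = C (C (γ / (2 * t))) from rfl]
    ring

end PolyMap

/-- The hypothesis `hdeg` is not needed: see `PolyMap.exists_hasNormalForm_conj`. -/
theorem corollary3p4 {K : Type*} [Field K] [IsAlgClosed K] [CharZero K]
    (u v : MvPolynomial (Fin 3) K) (h : MvPolynomial (Fin 2) K)
    (hzero : ∀ i, MvPolynomial.eval 0 (PolyMap.composedMap u v h i) = 0)
    (hindep : LinearIndependent K (PolyMap.composedMap u v h))
    (hnil : IsNilpotent (PolyMap.jacobian (PolyMap.composedMap u v h)))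
    (hdeg : Nat.gcd (PolyMap.restrictZero u).totalDegree h.totalDegree ≤ 3) :
    ∃ T : GL (Fin 3) K, PolyMap.HasNormalForm (PolyMap.conj T (PolyMap.composedMap u v h)) :=
  PolyMap.exists_hasNormalForm_conj u v h hzero hindep hnil
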